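/- **Conditional density given labels.** Let $0\le n<d$ be integers. Let $u$ be uniformly distributed on the unit sphere $\mathcal S^{d-1}\subset\mathbb R^d$, let $X=(X_1,\dots,X_n)$ be uniformly distributed on $\{-1,1\}^n$ and independent of $u$, and, conditionally on $u$ and $X$, let $z_1,\dots,z_n\in\mathbb R^d$ be independent with $z_i\sim\mathcal N(X_i u,\,I-uu^\top)$. Let $Z\in\mathbb R^{n\times d}$ be the matrix with rows $z_1^\top,\dots,z_n^\top$. For $t,a\in\mathbb R$ write $t_+^{a}=t^a$ if $t>0$ and $t_+^{a}=0$ if $t\le 0$ (so $t_+^0$ is the indicator of $t>0$). There is a constant $\mathcal Z\in(0,\infty)$, depending only on $n$ and $d$, such that for every $x\in\{-1,1\}^n$ the conditional distribution $\mu_x$ of $Z$ given $X=x$ is absolutely continuous with respect to Lebesgue measure on $\mathbb R^{n\times d}$, with density $$\frac{d\mu_x}{dZ}(Z)=\begin{cases}\mathcal Z^{-1}\exp\!\left(-\tfrac12\operatorname{Tr}(H)\right)\det(H)^{-1/2}\,\bigl(1-x^\top H^{-1}x\bigr)_+^{\frac{d-n-2}{2}} & \text{if } H \text{ is positive definite},\\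 0&\text{otherwise,}\end{cases}$$ for Lebesgue-almost every $Z$, where $H=ZZ^\top$ (so $\operatorname{Tr}(H)=\|Z\|_F^2$). Moreover $\mathcal Z$ is the normalization constant: for every $x\in\{-1,1\}^n$ the function on the right without the factor $\mathcal Z^{-1}$ is Lebesgue integrable with integral $\mathcal Z$. -/

import Mathlib

open MeasureTheory ProbabilityTheory Matrix
open scoped MatrixOrder

/-- The unit sphere of `ℝ^d`. -/
abbrev UnitSphere (d : ℕ) : Type := Metric.sphere (0 : EuclideanSpace ℝ (Fin d)) 1

/-- The uniform probability measure on the unit sphere of `ℝ^d` (for `1 ≤ d`): surface measure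
divided by its total mass. -/
noncomputable def uniformSphere (d : ℕ) : Measure (UnitSphere d) :=
  ((volume : Measure (EuclideanSpace ℝ (Fin d))).toSphere Set.univ)⁻¹ •
    (volume : Measure (EuclideanSpace ℝ (Fin d))).toSphere

/-- The law of `n` independent labels, each uniform on `{-1, 1}`. -/
noncomputable def labelLaw (n : ℕ) : Measure (Fin n → ℝ) :=
  Measure.pi fun _ => uniformOn ({-1, 1} : Set ℝ)

/-- The covariance matrix `I - u uᵀ`. -/
def clusterCov {d : ℕ} (u : UnitSphere d) : Matrix (Fin d) (Fin d) ℝ :=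
  1 - vecMulVec (u : EuclideanSpace ℝ (Fin d)) (u : EuclideanSpace ℝ (Fin d))

/-- The law of the sample `(z₁, …, zₙ)` given the direction `u` and the labels `x`: the `zᵢ` are
independent, with `zᵢ` Gaussian of mean `xᵢ u` and covariance `I - u uᵀ`. -/
noncomputable def sampleLaw {n d : ℕ} (u : UnitSphere d) (x : Fin n → ℝ) :
    Measure (Fin n → EuclideanSpace ℝ (Fin d)) :=
  Measure.pi fun i => multivariateGaussian (x i • (u : EuclideanSpace ℝ (Fin d))) (clusterCov u)

theorem clusterCov_mul_self {d : ℕ} (u : UnitSphere d) :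
    clusterCov u * clusterCov u = clusterCov u := by
  have h : (u : EuclideanSpace ℝ (Fin d)).ofLp ⬝ᵥ (u : EuclideanSpace ℝ (Fin d)).ofLp = 1 := by
    have h2 := EuclideanSpace.real_norm_sq_eq (u : EuclideanSpace ℝ (Fin d))
    rw [norm_eq_of_mem_sphere u] at h2
    simp only [dotProduct, ← pow_two]
    linarith
  simp [clusterCov, sub_mul, mul_sub, vecMulVec_mul_vecMulVec, h]

theorem clusterCov_posSemidef {d : ℕ} (u : UnitSphere d) : (clusterCov u).PosSemidef := by
  have hT : (clusterCov u)ᴴ = clusterCov u := by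
    ext i j
    simp [clusterCov, vecMulVec_apply, Matrix.one_apply, eq_comm, mul_comm]
  have h := Matrix.posSemidef_conjTranspose_mul_self (clusterCov u)
  rwa [hT, clusterCov_mul_self] at h

theorem sqrt_clusterCov {d : ℕ} (u : UnitSphere d) :
    CFC.sqrt (clusterCov u) = clusterCov u :=
  CFC.sqrt_unique (clusterCov_mul_self u) (clusterCov_posSemidef u).nonneg

theorem sampleLaw_eq_map {n d : ℕ} (u : UnitSphere d) (x : Fin n → ℝ) :
    sampleLaw u x =
      (Measure.pi fun _ : Fin n => stdGaussian (EuclideanSpace ℝ (Fin d))).map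
        (fun g i => x i • (u : EuclideanSpace ℝ (Fin d)) + toEuclideanCLM (𝕜 := ℝ) (clusterCov u) (g i)) := by
  unfold sampleLaw multivariateGaussian
  rw [sqrt_clusterCov]
  exact (Measure.pi_map_pi (fun i => by fun_prop)).symm

theorem measurable_sampleLaw (n d : ℕ) :
    Measurable fun p : UnitSphere d × (Fin n → ℝ) => sampleLaw p.1 p.2 := by
  simp_rw [sampleLaw_eq_map]
  have hF : Measurable fun q : (UnitSphere d × (Fin n → ℝ)) × (Fin n → EuclideanSpace ℝ (Fin d)) =>
      (fun i => q.1.2 i • (q.1.1 : EuclideanSpace ℝ (Fin d)) +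
        toEuclideanCLM (𝕜 := ℝ) (clusterCov q.1.1) (q.2 i)) := by
    refine Continuous.measurable (continuous_pi fun i => ?_)
    refine Continuous.add (by fun_prop) ?_
    have h : Continuous fun q : (UnitSphere d × (Fin n → ℝ)) × (Fin n → EuclideanSpace ℝ (Fin d)) =>
        (clusterCov q.1.1 *ᵥ (q.2 i).ofLp) := by
      refine continuous_pi fun j => ?_
      simp only [clusterCov, Matrix.mulVec, dotProduct, Matrix.sub_apply, vecMulVec_apply]
      fun_prop
    exact (PiLp.continuous_toLp 2 _).comp h
  refine Measure.measurable_of_measurable_coe _ fun s hs => ?_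
  have h (p : UnitSphere d × (Fin n → ℝ)) := Measure.map_apply
    (μ := Measure.pi fun _ : Fin n => stdGaussian (EuclideanSpace ℝ (Fin d)))
    (hF.comp (measurable_prodMk_left (x := p))) hs
  convert measurable_measure_prodMk_left
    (ν := Measure.pi fun _ : Fin n => stdGaussian (EuclideanSpace ℝ (Fin d))) (hF hs) using 1
  exact funext h

/-- The conditional law of the sample given direction and labels, as a Markov kernel. -/
noncomputable def sampleKernel (n d : ℕ) :
    Kernel (UnitSphere d × (Fin n → ℝ)) (Fin n → EuclideanSpace ℝ (Fin d)) where
  toFun p := sampleLaw p.1 p.2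
  measurable' := measurable_sampleLaw n d

instance isMarkovKernel_sampleKernel (n d : ℕ) : IsMarkovKernel (sampleKernel n d) where
  isProbabilityMeasure p := by
    change IsProbabilityMeasure (sampleLaw p.1 p.2)
    unfold sampleLaw
    infer_instance

/-- The joint law of `((u, x), Z)` in the Gaussian clustering model with covariance `I - u uᵀ`:
`u` is uniform on the sphere, the labels `x` are independent of `u` and uniform on `{-1, 1}ⁿ`,
and given `(u, x)` the rows of `Z` are independent with `zᵢ ∼ N(xᵢ u, I - u uᵀ)`. -/
noncomputable def clusteringLaw (n d : ℕ) :
    Measure ((UnitSphere d × (Fin n → ℝ)) × (Fin n → EuclideanSpace ℝ (Fin d))) :=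
  ((uniformSphere d).prod (labelLaw n)).compProd (sampleKernel n d)

/-- The conditional law of `Z` given that the label vector equals `x` (an event of probability
`2⁻ⁿ` when `x ∈ {-1, 1}ⁿ`). -/
noncomputable def lawGivenLabels {n : ℕ} (d : ℕ) (x : Fin n → ℝ) :
    Measure (Fin n → EuclideanSpace ℝ (Fin d)) :=
  (ProbabilityTheory.cond (clusteringLaw n d) {ω | ω.1.2 = x}).map fun ω => ω.2

/-- The Gram matrix `H = Z Zᵀ` of the matrix `Z` with rows `z₁, …, zₙ`. -/
def gramMatrix {n d : ℕ} (Z : Fin n → EuclideanSpace ℝ (Fin d)) : Matrix (Fin n) (Fin n) ℝ :=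
  (Matrix.of fun i j => Z i j) * (Matrix.of fun i j => Z i j)ᵀ

open Classical in
/-- The truncated power `t₊ ^ a`, equal to `t ^ a` for `t > 0` and to `0` for `t ≤ 0`; for `a = 0`
it is the indicator of `t > 0`. -/
noncomputable def posPartPow (t a : ℝ) : ℝ := if 0 < t then t ^ a else 0

open Classical in
/-- The unnormalised density
`exp (-Tr H / 2) · det(H)^(-1/2) · (1 - xᵀ H⁻¹ x)₊ ^ ((d - n - 2) / 2)` where `H = Z Zᵀ` is positive
definite, and `0` elsewhere. -/
noncomputable def unnormalizedDensity {n d : ℕ} (x : Fin n → ℝ)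
    (Z : Fin n → EuclideanSpace ℝ (Fin d)) : ℝ :=
  if (gramMatrix Z).PosDef then
    Real.exp (-(1 / 2) * (gramMatrix Z).trace) * (gramMatrix Z).det ^ (-(1 / 2) : ℝ) *
      posPartPow (1 - x ⬝ᵥ ((gramMatrix Z)⁻¹ *ᵥ x)) (((d : ℝ) - n - 2) / 2)
  else 0

/-! Given `u`, each row is Gaussian on the hyperplane `⟪u, z⟫ = xᵢ`, so its law is singular; a
density appears only after averaging over `u`. The hyperplane law is first thickened: Lebesgue
measure on the slab `1 ≤ ⟪u, z⟫ ≤ 2`, suitably weighted, is carried by `z ↦ (xᵢ / ⟪u, z⟫) z` to a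
multiple of it (`exists_map_slabWeight_eq`). The average of a test function `F` over `u` and `Z`
becomes an integral against surface measure times Lebesgue measure, of a function of `Z` and the
numbers `yᵢ = ⟪u, zᵢ⟫` alone, and Fubini applies.

For fixed `Z` with independent rows, `y` has density proportional to `det(H)^(-1/2) (1 - yᵀ H⁻¹ y)₊
^ ((d - n - 2) / 2)` (`lintegral_inner_toSphere`). A linear change of variables reduces this to the
marginal of the sphere on `n` orthonormal coordinates (`lintegral_inlCoord_toSphere`).

For fixed `y`, scaling the rows by `xᵢ / yᵢ` turns that density at `y` into the one at `x`, up to a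
factor depending on `y` only (`projDensity_smul`), and turns the slab weights into `exp (-Tr H /
2)`. What depends on `y` integrates to a constant, so `K · E[F] = C ∫ F · density` with `K` and `C`
independent of `x` and `F` (`exists_lintegral_sampleLaw_uniformSphere_eq`). Taking `F = 1` gives the
normalization `K / C`; indicators give the density. -/

/-! ### Product measures, polar coordinates and scaling -/

theorem lintegral_pi_prod {α : Type*} [MeasurableSpace α] {n : ℕ} (μ : Fin n → Measure α)
    [∀ i, SigmaFinite (μ i)] (f : Fin n → α → ENNReal) (hf : ∀ i, Measurable (f i)) :
    ∫⁻ z, ∏ i, f i (z i) ∂Measure.pi μ = ∏ i, ∫⁻ a, f i a ∂μ i := by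
  induction n with
  | zero => simp
  | succ n ih =>
    have hmeas : Measurable fun p : α × (Fin n → α) => f 0 p.1 * ∏ i : Fin n, f i.succ (p.2 i) :=
      ((hf 0).comp measurable_fst).mul
        (Finset.measurable_prod _ fun i _ => (hf i.succ).comp (by fun_prop))
    have h := (measurePreserving_piFinSuccAbove μ 0).lintegral_comp hmeas
    simp only [MeasurableEquiv.piFinSuccAbove_apply, Fin.insertNthEquiv_zero,
      Fin.consEquiv_symm_apply, Fin.tail] at h
    simp only [Fin.prod_univ_succ]
    refine h.trans ?_
    rw [lintegral_prod_mul (f := f 0) (g := fun y : Fin n → α => ∏ i : Fin n, f i.succ (y i))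
      (hf 0).aemeasurable
      (Finset.measurable_prod _ fun i _ => (hf i.succ).comp (by fun_prop)).aemeasurable]
    exact congrArg _ (ih (fun i => μ i.succ) (fun i => f i.succ) fun i => hf i.succ)

theorem pi_withDensity {α : Type*} [MeasurableSpace α] {n : ℕ} (μ : Fin n → Measure α)
    [∀ i, SigmaFinite (μ i)] (f : Fin n → α → ENNReal) (hf : ∀ i, Measurable (f i))
    [∀ i, SigmaFinite ((μ i).withDensity (f i))] :
    Measure.pi (fun i => (μ i).withDensity (f i)) =
      (Measure.pi μ).withDensity fun z => ∏ i, f i (z i) := by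
  refine (Measure.pi_eq fun s hs => ?_)
  rw [withDensity_apply _ (MeasurableSet.univ_pi hs), Measure.restrict_pi_pi,
    lintegral_pi_prod _ _ hf]
  exact Finset.prod_congr rfl fun i _ => (withDensity_apply _ (hs i)).symm

theorem pi_smul_measure {α : Type*} [MeasurableSpace α] {n : ℕ} (μ : Fin n → Measure α)
    [∀ i, SigmaFinite (μ i)] (c : Fin n → ENNReal) (hc : ∀ i, c i ≠ ⊤) :
    Measure.pi (fun i => c i • μ i) = (∏ i, c i) • Measure.pi μ := by
  have (i : Fin n) : SigmaFinite (c i • μ i) := by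
    rw [← withDensity_const]
    exact SigmaFinite.withDensity_of_ne_top (by simp [hc])
  refine Measure.pi_eq fun s hs => ?_
  simp [Measure.pi_pi, Finset.prod_mul_distrib]

theorem lintegral_polar {E : Type*} [NormedAddCommGroup E] [NormedSpace ℝ E] [MeasurableSpace E]
    [BorelSpace E] [FiniteDimensional ℝ E] [Nontrivial E] (μ : Measure E) [μ.IsAddHaarMeasure]
    {f : E → ENNReal} (hf : Measurable f) :
    ∫⁻ x, f x ∂μ = ∫⁻ u : Metric.sphere (0 : E) 1, (∫⁻ r in Set.Ioi (0 : ℝ),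
      ENNReal.ofReal (r ^ (Module.finrank ℝ E - 1)) * f (r • (u : E))) ∂μ.toSphere := by
  calc ∫⁻ x, f x ∂μ = ∫⁻ x : ({(0)}ᶜ : Set E), f x ∂(μ.comap (↑)) := by
        rw [lintegral_subtype_comap (measurableSet_singleton _).compl, restrict_compl_singleton]
    _ = ∫⁻ p, f ((p.2 : ℝ) • (p.1 : E)) ∂μ.toSphere.prod
          (Measure.volumeIoiPow (Module.finrank ℝ E - 1)) := by
        rw [← μ.measurePreserving_homeomorphUnitSphereProd.lintegral_comp_emb
          (Homeomorph.measurableEmbedding _)]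
        refine lintegral_congr fun x => ?_
        have hx : (x : E) ≠ 0 := x.2
        congr 1
        rw [← homeomorphUnitSphereProd_symm_apply_coe]
        simp
    _ = _ := by
        rw [lintegral_prod _ (by fun_prop)]
        refine lintegral_congr fun u => ?_
        rw [Measure.volumeIoiPow, lintegral_withDensity_eq_lintegral_mul _ (by fun_prop)
          (by fun_prop)]
        exact lintegral_subtype_comap measurableSet_Ioi
          fun r : ℝ => ENNReal.ofReal (r ^ (Module.finrank ℝ E - 1)) * f (r • (u : E))

theorem lintegral_comp_smul {E : Type*} [NormedAddCommGroup E] [NormedSpace ℝ E]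
    [MeasurableSpace E] [BorelSpace E] [FiniteDimensional ℝ E] (μ : Measure E) [μ.IsAddHaarMeasure]
    {f : E → ENNReal} (hf : Measurable f) {c : ℝ} (hc : c ≠ 0) :
    ∫⁻ x, f (c • x) ∂μ = ENNReal.ofReal |(c ^ Module.finrank ℝ E)⁻¹| * ∫⁻ x, f x ∂μ := by
  rw [← lintegral_map hf (by fun_prop), Measure.map_addHaar_smul μ hc, lintegral_smul_measure,
    smul_eq_mul]

theorem pi_map_smul {E : Type*} [NormedAddCommGroup E] [NormedSpace ℝ E]
    [MeasurableSpace E] [BorelSpace E] [FiniteDimensional ℝ E] (μ : Measure E) [μ.IsAddHaarMeasure]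
    {n : ℕ} (c : Fin n → ℝ) (hc : ∀ i, c i ≠ 0) :
    (Measure.pi fun _ : Fin n => μ).map (fun z i => c i • z i) =
      ENNReal.ofReal (∏ i, |(c i ^ Module.finrank ℝ E)⁻¹|) • Measure.pi fun _ : Fin n => μ := by
  have h (i : Fin n) : SigmaFinite (μ.map fun x => c i • x) := by
    rw [Measure.map_addHaar_smul μ (hc i), ← withDensity_const]
    exact SigmaFinite.withDensity_of_ne_top (by simp)
  rw [Measure.pi_map_pi (μ := fun _ => μ) (f := fun i x => c i • x) (fun i => by fun_prop)]
  simp_rw [fun i => Measure.map_addHaar_smul μ (hc i)]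
  rw [pi_smul_measure _ _ (by simp), ENNReal.ofReal_prod_of_nonneg (by simp)]

/-! ### The singular Gaussian as the image of a measure on a slab -/

/-- The point with coordinates `(s, w)` in the orthonormal basis `b`. -/
noncomputable def consCoord {m : ℕ} {E : Type*} [NormedAddCommGroup E] [InnerProductSpace ℝ E]
    (b : OrthonormalBasis (Fin (m + 1)) ℝ E) (p : ℝ × (Fin m → ℝ)) : E :=
  b.repr.symm (WithLp.toLp 2 (Fin.cons p.1 p.2 : Fin (m + 1) → ℝ))

section consCoord

variable {m : ℕ} {E : Type*} [NormedAddCommGroup E] [InnerProductSpace ℝ E]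
  (b : OrthonormalBasis (Fin (m + 1)) ℝ E)

theorem consCoord_eq (p : ℝ × (Fin m → ℝ)) :
    consCoord b p = p.1 • b 0 + ∑ i : Fin m, p.2 i • b i.succ := by
  simp [consCoord, ← OrthonormalBasis.sum_repr_symm, Fin.sum_univ_succ]

theorem smul_consCoord (c : ℝ) (p : ℝ × (Fin m → ℝ)) :
    c • consCoord b p = consCoord b (c * p.1, c • p.2) := by
  simp [consCoord_eq, smul_add, smul_smul, Finset.smul_sum]

theorem inner_zero_consCoord (p : ℝ × (Fin m → ℝ)) : inner ℝ (b 0) (consCoord b p) = p.1 := by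
  rw [← b.repr_apply_apply, consCoord]
  simp

theorem norm_sq_consCoord (p : ℝ × (Fin m → ℝ)) :
    ‖consCoord b p‖ ^ 2 = p.1 ^ 2 + ∑ i, p.2 i ^ 2 := by
  rw [consCoord, LinearIsometryEquiv.norm_map, EuclideanSpace.real_norm_sq_eq]
  simp [Fin.sum_univ_succ]

variable [MeasurableSpace E] [BorelSpace E] [FiniteDimensional ℝ E]

theorem measurePreserving_consCoord : MeasurePreserving (consCoord b) volume volume := by
  have h := b.measurePreserving_repr_symm.comp ((PiLp.volume_preserving_toLp (Fin (m + 1))).comp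
    (volume_preserving_piFinSuccAbove (fun _ : Fin (m + 1) => ℝ) 0).symm)
  have he : consCoord b = b.repr.symm ∘ WithLp.toLp 2 ∘
      (MeasurableEquiv.piFinSuccAbove (fun _ : Fin (m + 1) => ℝ) 0).symm := by
    funext p
    exact congrArg (fun v => b.repr.symm (WithLp.toLp 2 v)) (Fin.insertNth_zero' p.1 p.2).symm
  rwa [he]

end consCoord

theorem toEuclideanCLM_clusterCov {d : ℕ} (u : UnitSphere d) (v : EuclideanSpace ℝ (Fin d)) :
    toEuclideanCLM (𝕜 := ℝ) (clusterCov u) v =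
      v - inner ℝ (u : EuclideanSpace ℝ (Fin d)) v • (u : EuclideanSpace ℝ (Fin d)) := by
  ext i
  simp [clusterCov, vecMulVec_mulVec, PiLp.inner_apply, dotProduct, mul_comm]

theorem exists_orthonormalBasis_zero_eq {m : ℕ} (u : UnitSphere (m + 1)) :
    ∃ b : OrthonormalBasis (Fin (m + 1)) ℝ (EuclideanSpace ℝ (Fin (m + 1))), b 0 = u := by
  have hv : Orthonormal ℝ (({0} : Set (Fin (m + 1))).domRestrict
      fun _ => (u : EuclideanSpace ℝ (Fin (m + 1)))) :=
    ⟨fun _ => norm_eq_of_mem_sphere u, fun i j hij => absurd (Subsingleton.elim i j) hij⟩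
  obtain ⟨b, hb⟩ := hv.exists_orthonormalBasis_extension_of_card_eq (by simp)
  exact ⟨b, hb 0 rfl⟩

/-- The covariance is an orthogonal projection, hence its own square root: it deletes the coordinate
along `u` of a standard Gaussian and keeps the other `m`, and the mean puts `ε` in the deleted
place. -/
theorem multivariateGaussian_clusterCov_eq_map {m : ℕ} (u : UnitSphere (m + 1))
    (b : OrthonormalBasis (Fin (m + 1)) ℝ (EuclideanSpace ℝ (Fin (m + 1)))) (hb : b 0 = u) (ε : ℝ) :
    multivariateGaussian (ε • (u : EuclideanSpace ℝ (Fin (m + 1)))) (clusterCov u) =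
      (Measure.pi fun _ : Fin m => gaussianReal 0 1).map fun w => consCoord b (ε, w) := by
  have htail : (Measure.pi fun _ : Fin (m + 1) => gaussianReal 0 1).map Fin.tail =
      Measure.pi fun _ : Fin m => gaussianReal 0 1 := by
    have h := (measurePreserving_snd (μ := gaussianReal 0 1)
      (ν := Measure.pi fun _ : Fin m => gaussianReal 0 1)).comp
      (measurePreserving_piFinSuccAbove (fun _ : Fin (m + 1) => gaussianReal 0 1) 0)
    exact h.map_eq
  have hc : Continuous fun w : Fin m → ℝ => consCoord b (ε, w) := by
    simp only [consCoord_eq]; fun_prop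
  rw [multivariateGaussian, sqrt_clusterCov, stdGaussian_eq_map_pi_orthonormalBasis b, ← htail,
    Measure.map_map hc.measurable (by unfold Fin.tail; fun_prop), Measure.map_map (by fun_prop) (by fun_prop)]
  congr 1
  ext1 x
  have hx : inner ℝ (b 0) (∑ i, x i • b i) = x 0 := by
    rw [b.orthonormal.inner_right_fintype]
  simp only [Function.comp_apply, toEuclideanCLM_clusterCov, ← hb, hx, consCoord_eq]
  rw [Fin.sum_univ_succ]
  simp [Fin.tail]

/-- The density of the slab `1 ≤ t ≤ 2` used to rescale a row `z` with `⟪u, z⟫ = t`. -/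
noncomputable def slabWeight {E : Type*} [NormedAddCommGroup E] [NormedSpace ℝ E] (ε t : ℝ) (z : E) :
    ENNReal :=
  (Set.Icc (1 : ℝ) 2).indicator 1 t * ENNReal.ofReal (Real.exp (-(1 / 2) * ‖(ε / t) • z‖ ^ 2))

theorem pi_gaussianReal_eq_withDensity (m : ℕ) :
    (Measure.pi fun _ : Fin m => gaussianReal 0 1) =
      volume.withDensity fun w => ∏ i, gaussianPDF 0 1 (w i) := by
  have h : gaussianReal 0 1 = volume.withDensity (gaussianPDF 0 1) :=
    gaussianReal_of_var_ne_zero 0 one_ne_zero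
  have : SigmaFinite (volume.withDensity (gaussianPDF 0 1)) := by rw [← h]; infer_instance
  rw [h, pi_withDensity (fun _ => volume) _ fun _ => measurable_gaussianPDF 0 1]
  rfl

theorem ofReal_exp_norm_sq_consCoord {m : ℕ} {E : Type*} [NormedAddCommGroup E]
    [InnerProductSpace ℝ E] (b : OrthonormalBasis (Fin (m + 1)) ℝ E) {ε : ℝ} (hε : ε ^ 2 = 1)
    (w : Fin m → ℝ) :
    ENNReal.ofReal (Real.exp (-(1 / 2) * ‖consCoord b (ε, w)‖ ^ 2)) =
      ENNReal.ofReal (Real.exp (-(1 / 2)) * √(2 * Real.pi) ^ m) * ∏ i, gaussianPDF 0 1 (w i) := by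
  have h0 : √(2 * Real.pi) ≠ 0 := by positivity
  simp only [gaussianPDF, gaussianPDFReal]
  rw [← ENNReal.ofReal_prod_of_nonneg (fun i _ => by positivity),
    ← ENNReal.ofReal_mul (by positivity), norm_sq_consCoord]
  congr 1
  simp only [Finset.prod_mul_distrib, Finset.prod_const, Finset.card_univ, Fintype.card_fin,
    hε, ← Real.exp_sum]
  simp only [NNReal.coe_one, mul_one, sub_zero]
  rw [mul_assoc, ← mul_assoc (_ ^ m), ← mul_pow, mul_inv_cancel₀ h0, one_pow, one_mul,
    ← Real.exp_add, mul_add, mul_one, Finset.mul_sum]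
  congr 2
  exact Finset.sum_congr rfl fun i _ => by ring

/-- In coordinates `(s, w)` with first axis `u`, the map is `(s, w) ↦ (ε, (ε / s) w)`. On each slice
the weight is the Gaussian factor of the image point, so the slices have the same image up to the
Jacobian `s ^ m`. It matters later that `K` depends on neither `u` nor `ε`. -/
theorem exists_map_slabWeight_eq (m : ℕ) :
    ∃ K : ENNReal, K ≠ 0 ∧ K ≠ ⊤ ∧ ∀ (u : UnitSphere (m + 1)) (ε : ℝ), (ε = -1 ∨ ε = 1) →
      (volume.withDensity fun z : EuclideanSpace ℝ (Fin (m + 1)) =>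
          slabWeight ε (inner ℝ (u : EuclideanSpace ℝ (Fin (m + 1))) z) z).map
        (fun z => (ε / inner ℝ (u : EuclideanSpace ℝ (Fin (m + 1))) z) • z) =
      K • multivariateGaussian (ε • (u : EuclideanSpace ℝ (Fin (m + 1)))) (clusterCov u) := by
  -- `K₁` collects the slice Jacobians, which lie between `1` and `2 ^ m` on the slab. `K₂` is the
  -- ratio of `exp (-‖(ε, w)‖² / 2)` to the normalized Gaussian density in `w`, its `exp (-1/2)`
  -- coming from `ε² = 1`.
  set K₁ : ENNReal := ∫⁻ s in Set.Icc (1 : ℝ) 2, ENNReal.ofReal (s ^ m)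
  set K₂ : ENNReal := ENNReal.ofReal (Real.exp (-(1 / 2)) * √(2 * Real.pi) ^ m)
  refine ⟨K₁ * K₂, mul_ne_zero ?_ ?_, ENNReal.mul_ne_top ?_ ENNReal.ofReal_ne_top,
    fun u ε hε => ?_⟩
  · have h : ∫⁻ s in Set.Icc (1 : ℝ) 2, 1 ≤ K₁ :=
      setLIntegral_mono (by fun_prop) fun s hs => by
        rw [← ENNReal.ofReal_one]
        exact ENNReal.ofReal_le_ofReal (one_le_pow₀ hs.1)
    rw [lintegral_const, one_mul, Measure.restrict_apply_univ, Real.volume_Icc] at h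
    norm_num at h
    exact (zero_lt_one.trans_le h).ne'
  · simp only [K₂, ne_eq, ENNReal.ofReal_eq_zero, not_le]; positivity
  · have h : K₁ ≤ ∫⁻ s in Set.Icc (1 : ℝ) 2, ENNReal.ofReal (2 ^ m) :=
      setLIntegral_mono (by fun_prop) fun s hs =>
        ENNReal.ofReal_le_ofReal (pow_le_pow_left₀ (by linarith [hs.1]) hs.2 m)
    refine ne_top_of_le_ne_top ?_ h
    rw [lintegral_const, Measure.restrict_apply_univ, Real.volume_Icc]
    exact ENNReal.mul_ne_top ENNReal.ofReal_ne_top ENNReal.ofReal_ne_top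
  obtain ⟨b, hb⟩ := exists_orthonormalBasis_zero_eq u
  have hε0 : ε ≠ 0 := by rcases hε with rfl | rfl <;> norm_num
  have hε2 : ε ^ 2 = 1 := by rcases hε with rfl | rfl <;> norm_num
  have hεa : |ε| = 1 := by rcases hε with rfl | rfl <;> norm_num
  have hW : Measurable fun z : EuclideanSpace ℝ (Fin (m + 1)) =>
      slabWeight ε (inner ℝ (u : EuclideanSpace ℝ (Fin (m + 1))) z) z := by
    unfold slabWeight
    refine Measurable.mul ((measurable_one.indicator measurableSet_Icc).comp (by fun_prop)) ?_
    fun_prop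
  have hT : Measurable fun z : EuclideanSpace ℝ (Fin (m + 1)) =>
      (ε / inner ℝ (u : EuclideanSpace ℝ (Fin (m + 1))) z) • z := by fun_prop
  have hc : Measurable fun w : Fin m → ℝ => consCoord b (ε, w) := by
    have : Continuous fun w : Fin m → ℝ => consCoord b (ε, w) := by
      simp only [consCoord_eq]; fun_prop
    exact this.measurable
  refine Measure.ext_of_lintegral _ fun f hf => ?_
  have hG : Measurable fun w : Fin m → ℝ =>
      ENNReal.ofReal (Real.exp (-(1 / 2) * ‖consCoord b (ε, w)‖ ^ 2)) * f (consCoord b (ε, w)) := by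
    fun_prop
  have hP : Measurable fun w : Fin m → ℝ => ∏ i, gaussianPDF 0 1 (w i) :=
    Finset.measurable_prod _ fun i _ => (measurable_gaussianPDF 0 1).comp (measurable_pi_apply i)
  have hWT : Measurable ((fun z => slabWeight ε (inner ℝ (u : EuclideanSpace ℝ (Fin (m + 1))) z) z) *
      fun z => f ((ε / inner ℝ (u : EuclideanSpace ℝ (Fin (m + 1))) z) • z)) :=
    hW.mul (hf.comp hT)
  rw [lintegral_smul_measure, multivariateGaussian_clusterCov_eq_map u b hb, lintegral_map hf hc,
    pi_gaussianReal_eq_withDensity, lintegral_withDensity_eq_lintegral_mul _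
      hP (g := fun w => f (consCoord b (ε, w))) (hf.comp hc), lintegral_map hf hT, lintegral_withDensity_eq_lintegral_mul _ hW
      (g := fun z => f ((ε / inner ℝ (u : EuclideanSpace ℝ (Fin (m + 1))) z) • z)) (hf.comp hT),
    ← (measurePreserving_consCoord b).lintegral_comp hWT,
    Measure.volume_eq_prod, lintegral_prod _
      (by exact (hWT.comp (measurePreserving_consCoord b).measurable).aemeasurable)]
  have hinner (s : ℝ) : ∫⁻ w : Fin m → ℝ,
      ((fun z => slabWeight ε (inner ℝ (u : EuclideanSpace ℝ (Fin (m + 1))) z) z) *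
        fun z => f ((ε / inner ℝ (u : EuclideanSpace ℝ (Fin (m + 1))) z) • z))
        (consCoord b (s, w)) =
      (Set.Icc (1 : ℝ) 2).indicator (fun s => ENNReal.ofReal (s ^ m)) s *
        ∫⁻ w : Fin m → ℝ, ENNReal.ofReal (Real.exp (-(1 / 2) * ‖consCoord b (ε, w)‖ ^ 2)) *
          f (consCoord b (ε, w)) := by
    by_cases hs : s ∈ Set.Icc (1 : ℝ) 2
    · have hs0 : 0 < s := by linarith [hs.1]
      -- Only the `m` coordinates of `w` are scaled by `ε / s`; since `|ε| = 1`, the Jacobian is `s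
      -- ^ m` for both signs.
      have h := lintegral_comp_smul volume hG (c := ε / s) (div_ne_zero hε0 hs0.ne')
      have hn : |((ε / s) ^ Module.finrank ℝ (Fin m → ℝ))⁻¹| = s ^ m := by
        simp [abs_inv, abs_pow, abs_div, hεa, abs_of_pos hs0]
      rw [hn] at h
      rw [Set.indicator_of_mem hs, ← h]
      refine lintegral_congr fun w => ?_
      simp only [Pi.mul_apply, slabWeight, ← hb, inner_zero_consCoord,
        Set.indicator_of_mem hs, Pi.one_apply, one_mul, smul_consCoord,
        div_mul_cancel₀ _ hs0.ne']
    · simp [slabWeight, ← hb, inner_zero_consCoord, Set.indicator_of_notMem hs]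
  simp_rw [hinner]
  rw [lintegral_mul_const _ (Measurable.indicator (by fun_prop) measurableSet_Icc),
    lintegral_indicator measurableSet_Icc, smul_eq_mul, mul_assoc]
  congr 1
  rw [← lintegral_const_mul' _ _ ENNReal.ofReal_ne_top]
  refine lintegral_congr fun w => ?_
  rw [ofReal_exp_norm_sq_consCoord b hε2, mul_assoc]
  rfl

/-! ### The substitution `y = a / √(1 + ‖a‖²)` from space to the unit ball -/

theorem image_div_sqrt_one_add_sq :
    (fun r : ℝ => r / √(1 + r ^ 2)) '' Set.Ioi 0 = Set.Ioo 0 1 := by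
  ext s
  constructor
  · rintro ⟨r, hr, rfl⟩
    have hr : 0 < r := hr
    have h : r < √(1 + r ^ 2) := Real.lt_sqrt_of_sq_lt (by linarith)
    exact ⟨by positivity, (div_lt_one (by positivity)).2 h⟩
  · rintro ⟨h0, h1⟩
    have hs : 0 < 1 - s ^ 2 := by nlinarith
    have hq : 0 < √(1 - s ^ 2) := Real.sqrt_pos.2 hs
    have h : 1 + (s / √(1 - s ^ 2)) ^ 2 = (√(1 - s ^ 2))⁻¹ ^ 2 := by
      rw [div_pow, inv_pow, Real.sq_sqrt hs.le]
      field_simp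
      ring
    refine ⟨s / √(1 - s ^ 2), div_pos h0 hq, ?_⟩
    simp only
    rw [h, Real.sqrt_sq (by positivity)]
    field_simp

theorem injOn_div_sqrt_one_add_sq :
    Set.InjOn (fun r : ℝ => r / √(1 + r ^ 2)) (Set.Ioi 0) := by
  intro a ha b hb h
  have ha : 0 < a := ha
  have hb : 0 < b := hb
  have h2 := congrArg (· ^ 2) h
  simp only [div_pow] at h2
  rw [Real.sq_sqrt (by positivity), Real.sq_sqrt (by positivity),
    div_eq_div_iff (by positivity) (by positivity)] at h2
  exact (pow_left_inj₀ ha.le hb.le two_ne_zero).1 (by linarith)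

theorem hasDerivAt_div_sqrt_one_add_sq (r : ℝ) :
    HasDerivAt (fun r : ℝ => r / √(1 + r ^ 2)) ((√(1 + r ^ 2))⁻¹ ^ 3) r := by
  have hp : 0 < 1 + r ^ 2 := by positivity
  have hs : 0 < √(1 + r ^ 2) := Real.sqrt_pos.2 hp
  have h1 : HasDerivAt (fun r : ℝ => 1 + r ^ 2) (2 * r) r := by
    simpa using (hasDerivAt_pow 2 r).const_add 1
  have h := (hasDerivAt_id r).div (h1.sqrt hp.ne') hs.ne'
  refine h.congr_deriv ?_
  have hq := Real.sq_sqrt hp.le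
  simp only [id_eq]
  field_simp
  linear_combination hq

theorem posPartPow_nonneg (t a : ℝ) : 0 ≤ posPartPow t a := by
  unfold posPartPow
  split_ifs with h
  · exact Real.rpow_nonneg h.le a
  · rfl

theorem measurable_posPartPow (a : ℝ) : Measurable fun t => posPartPow t a := by
  unfold posPartPow
  exact Measurable.ite measurableSet_Ioi (by fun_prop) measurable_const

/-- With `s = r / √(1 + r²)` one has `1 - s² = (1 + r²)⁻¹`. The power `1 - k` of the root is split
into two factors so that natural exponents suffice, `k = 0` included. -/
theorem posPartPow_one_sub_div_sqrt (k : ℕ) (r : ℝ) :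
    posPartPow (1 - (r / √(1 + r ^ 2)) ^ 2) (((k : ℝ) - 1) / 2) =
      √(1 + r ^ 2) * (√(1 + r ^ 2))⁻¹ ^ k := by
  have hp : 0 < 1 + r ^ 2 := by positivity
  have hs : 0 < √(1 + r ^ 2) := Real.sqrt_pos.2 hp
  have h : 1 - (r / √(1 + r ^ 2)) ^ 2 = √(1 + r ^ 2) ^ (-2 : ℝ) := by
    rw [Real.rpow_neg hs.le, Real.rpow_ofNat, div_pow, Real.sq_sqrt hp.le]
    field_simp
    ring
  rw [h, posPartPow, if_pos (by positivity), ← Real.rpow_mul hs.le,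
    show (-2 : ℝ) * (((k : ℝ) - 1) / 2) = 1 - k by ring, Real.rpow_sub hs, Real.rpow_one,
    Real.rpow_natCast, inv_pow, div_eq_mul_inv]

theorem lintegral_radial_substitution (n k : ℕ) (φ : ℝ → ENNReal) :
    ∫⁻ s in Set.Ioi (0 : ℝ), ENNReal.ofReal (s ^ n) *
        (φ s * ENNReal.ofReal (posPartPow (1 - s ^ 2) (((k : ℝ) - 1) / 2))) =
      ∫⁻ r in Set.Ioi (0 : ℝ), ENNReal.ofReal (r ^ n) *
        (φ (r / √(1 + r ^ 2)) * ENNReal.ofReal ((√(1 + r ^ 2))⁻¹ ^ (n + k + 2))) := by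
  calc _ = ∫⁻ s in Set.Ioo (0 : ℝ) 1, ENNReal.ofReal (s ^ n) *
        (φ s * ENNReal.ofReal (posPartPow (1 - s ^ 2) (((k : ℝ) - 1) / 2))) := by
        -- The truncated power vanishes for `s ≥ 1`, which confines the integral to the image of the
        -- substitution.
        rw [← lintegral_indicator measurableSet_Ioi, ← lintegral_indicator measurableSet_Ioo]
        refine lintegral_congr fun s => ?_
        by_cases h1 : s < 1
        · simp [Set.indicator, h1]
        · by_cases h0 : 0 < s
          · have : ¬ s ^ 2 < 1 := by nlinarith
            simp [Set.indicator, h1, posPartPow, this]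
          · simp [Set.indicator, h0]
    _ = _ := by
        rw [← image_div_sqrt_one_add_sq, lintegral_image_eq_lintegral_abs_deriv_mul
          measurableSet_Ioi (fun r _ => (hasDerivAt_div_sqrt_one_add_sq r).hasDerivWithinAt)
          injOn_div_sqrt_one_add_sq]
        refine setLIntegral_congr_fun measurableSet_Ioi fun r hr => ?_
        have hr : 0 < r := hr
        have hs : 0 < √(1 + r ^ 2) := Real.sqrt_pos.2 (by positivity)
        simp only [posPartPow_one_sub_div_sqrt, abs_of_pos (show 0 < (√(1 + r ^ 2))⁻¹ ^ 3 by positivity)]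
        rw [mul_left_comm (ENNReal.ofReal ((r / √(1 + r ^ 2)) ^ n)), mul_left_comm,
          mul_left_comm (ENNReal.ofReal (r ^ n)),
          ← ENNReal.ofReal_mul (by positivity), ← ENNReal.ofReal_mul (by positivity),
          ← ENNReal.ofReal_mul (by positivity)]
        congr 2
        simp only [div_pow, inv_pow, pow_add]
        field_simp

/-- The substitution is radial, so polar coordinates on both sides reduce it to one variable.
Dimension zero has no directions and is checked at its single point. -/
theorem lintegral_ball_substitution (n k : ℕ) {φ : EuclideanSpace ℝ (Fin n) → ENNReal}
    (hφ : Measurable φ) :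
    ∫⁻ a, φ ((√(1 + ‖a‖ ^ 2))⁻¹ • a) * ENNReal.ofReal ((√(1 + ‖a‖ ^ 2))⁻¹ ^ (n + k + 1)) =
      ∫⁻ y, φ y * ENNReal.ofReal (posPartPow (1 - ‖y‖ ^ 2) (((k : ℝ) - 1) / 2)) := by
  cases n with
  | zero =>
    refine lintegral_congr fun a => ?_
    rw [Subsingleton.elim a 0]
    simp [posPartPow]
  | succ n =>
    have hp := (measurable_posPartPow (((k : ℝ) - 1) / 2)).comp
      (g := fun t : ℝ => posPartPow t (((k : ℝ) - 1) / 2))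
      (f := fun y : EuclideanSpace ℝ (Fin (n + 1)) => 1 - ‖y‖ ^ 2) (by fun_prop)
    rw [lintegral_polar volume (by fun_prop), lintegral_polar volume (by exact hφ.mul hp.ennreal_ofReal)]
    refine lintegral_congr fun u => ?_
    have hu : ‖(u : EuclideanSpace ℝ (Fin (n + 1)))‖ = 1 := norm_eq_of_mem_sphere u
    simp only [norm_smul, hu, mul_one, Real.norm_eq_abs, sq_abs, smul_smul,
      finrank_euclideanSpace_fin, Nat.add_sub_cancel]
    rw [lintegral_radial_substitution n k fun s => φ (s • (u : EuclideanSpace ℝ (Fin (n + 1))))]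
    refine lintegral_congr fun r => ?_
    rw [div_eq_inv_mul, show n + 1 + k + 1 = n + k + 2 by ring]

/-! ### The marginal of surface measure on `n` orthonormal coordinates -/

section SumCoord

variable {n k : ℕ} {E : Type*} [NormedAddCommGroup E] [InnerProductSpace ℝ E]
  (b : OrthonormalBasis (Fin n ⊕ Fin k) ℝ E)

/-- The point with coordinates `(a, c)` in the orthonormal basis `b`. -/
noncomputable def sumCoord (p : EuclideanSpace ℝ (Fin n) × EuclideanSpace ℝ (Fin k)) : E :=
  b.repr.symm (WithLp.toLp 2 (Sum.elim p.1 p.2))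

/-- The first `n` coordinates in the orthonormal basis `b`. -/
noncomputable def inlCoord (v : E) : EuclideanSpace ℝ (Fin n) :=
  WithLp.toLp 2 fun i => inner ℝ (b (Sum.inl i)) v

theorem inlCoord_sumCoord (p : EuclideanSpace ℝ (Fin n) × EuclideanSpace ℝ (Fin k)) :
    inlCoord b (sumCoord b p) = p.1 := by
  ext i
  simp [inlCoord, sumCoord, ← b.repr_apply_apply]

theorem inlCoord_smul (r : ℝ) (v : E) : inlCoord b (r • v) = r • inlCoord b v := by
  ext i
  simp [inlCoord, inner_smul_right]

theorem norm_sq_sumCoord (p : EuclideanSpace ℝ (Fin n) × EuclideanSpace ℝ (Fin k)) :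
    ‖sumCoord b p‖ ^ 2 = ‖p.1‖ ^ 2 + ‖p.2‖ ^ 2 := by
  rw [sumCoord, LinearIsometryEquiv.norm_map]
  simp [EuclideanSpace.real_norm_sq_eq]

theorem norm_sumCoord (p : EuclideanSpace ℝ (Fin n) × EuclideanSpace ℝ (Fin k)) :
    ‖sumCoord b p‖ = √(‖p.1‖ ^ 2 + ‖p.2‖ ^ 2) := by
  rw [← norm_sq_sumCoord b, Real.sqrt_sq (norm_nonneg _)]

variable [MeasurableSpace E] [BorelSpace E] [FiniteDimensional ℝ E]

theorem measurable_inlCoord : Measurable (inlCoord b) := by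
  unfold inlCoord
  fun_prop

theorem measurePreserving_sumCoord : MeasurePreserving (sumCoord b) volume volume := by
  have h := b.measurePreserving_repr_symm.comp ((PiLp.volume_preserving_toLp (Fin n ⊕ Fin k)).comp
    ((volume_measurePreserving_sumPiEquivProdPi_symm (fun _ : Fin n ⊕ Fin k => ℝ)).comp
      (MeasurePreserving.prod (PiLp.volume_preserving_ofLp (Fin n))
        (PiLp.volume_preserving_ofLp (Fin k)))))
  have he : sumCoord b = b.repr.symm ∘ WithLp.toLp 2 ∘
      (MeasurableEquiv.sumPiEquivProdPi fun _ : Fin n ⊕ Fin k => ℝ).symm ∘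
        Prod.map WithLp.ofLp WithLp.ofLp := by
    funext p
    refine congrArg (fun v => b.repr.symm (WithLp.toLp 2 v)) ?_
    ext (i | i) <;> rfl
  rwa [he]

end SumCoord

/-- The indicator of `r < 1`. -/
noncomputable def belowOne (r : ℝ) : ENNReal := (Set.Iio (1 : ℝ)).indicator 1 r

@[fun_prop]
theorem measurable_belowOne : Measurable belowOne :=
  measurable_one.indicator measurableSet_Iio

theorem belowOne_of_lt {r : ℝ} (h : r < 1) : belowOne r = 1 :=
  Set.indicator_of_mem (show r ∈ Set.Iio (1 : ℝ) from h) _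

theorem belowOne_of_not_lt {r : ℝ} (h : ¬ r < 1) : belowOne r = 0 :=
  Set.indicator_of_notMem (show r ∉ Set.Iio (1 : ℝ) from h) _

/-- The mass of the `m`-th power of the radius on the unit interval. -/
noncomputable def radialMass (m : ℕ) : ENNReal :=
  ∫⁻ r in Set.Ioi (0 : ℝ), ENNReal.ofReal (r ^ m) * belowOne r

theorem radialMass_ne_zero (m : ℕ) : radialMass m ≠ 0 := by
  rw [radialMass, ← pos_iff_ne_zero, setLIntegral_pos_iff (by fun_prop)]
  refine lt_of_lt_of_le ?_ (measure_mono (s := Set.Ioo (0 : ℝ) 1) fun r hr => ⟨?_, hr.1⟩)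
  · simp
  · have h0 : 0 < r := hr.1
    simp [belowOne_of_lt hr.2, h0]

theorem radialMass_ne_top (m : ℕ) : radialMass m ≠ ⊤ := by
  have h : radialMass m ≤ ∫⁻ r in Set.Ioi (0 : ℝ), belowOne r := by
    refine setLIntegral_mono (by fun_prop) fun r hr => ?_
    have hr : 0 < r := hr
    by_cases h1 : r < 1
    · rw [belowOne_of_lt h1, mul_one]
      exact ENNReal.ofReal_le_one.2 (pow_le_one₀ hr.le h1.le)
    · simp [belowOne_of_not_lt h1]
  refine ne_top_of_le_ne_top ?_ h
  simp only [belowOne]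
  rw [lintegral_indicator_one measurableSet_Iio, Measure.restrict_apply measurableSet_Iio,
    Set.Iio_inter_Ioi]
  simp

theorem lintegral_radial_scaled (m : ℕ) {ρ : ℝ} (hρ : 0 < ρ) :
    ∫⁻ r in Set.Ioi (0 : ℝ), ENNReal.ofReal (r ^ m) * belowOne (r * ρ) =
      ENNReal.ofReal (ρ⁻¹ ^ (m + 1)) * radialMass m := by
  have hm : Measurable ((Set.Ioi (0 : ℝ)).indicator
      fun r : ℝ => ENNReal.ofReal (r ^ m) * belowOne r) :=
    Measurable.indicator (by fun_prop) measurableSet_Ioi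
  have h := lintegral_comp_smul volume hm hρ.ne'
  rw [lintegral_indicator measurableSet_Ioi] at h
  simp only [Module.finrank_self, pow_one, abs_of_pos (inv_pos.2 hρ)] at h
  rw [pow_succ, ENNReal.ofReal_mul (by positivity), mul_assoc, radialMass, ← h,
    ← lintegral_const_mul' _ _ ENNReal.ofReal_ne_top, ← lintegral_indicator measurableSet_Ioi]
  refine lintegral_congr fun r => ?_
  by_cases hr : 0 < r
  · rw [Set.indicator_of_mem (show r ∈ Set.Ioi (0 : ℝ) from hr),
      Set.indicator_of_mem (show ρ • r ∈ Set.Ioi (0 : ℝ) from mul_pos hρ hr), smul_eq_mul,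
      ← mul_assoc, ← ENNReal.ofReal_mul (by positivity), mul_comm r ρ, inv_pow, mul_pow,
      inv_mul_cancel_left₀ (by positivity)]
  · have : ¬ 0 < ρ * r := by rwa [mul_pos_iff_of_pos_left hρ]
    simp [hr, this]

/-- The test function `φ`, evaluated at the projection to `A` of the direction of `(a, c)` with
`‖c‖ = r`, and cut off outside the unit ball. -/
noncomputable def conical {A : Type*} [NormedAddCommGroup A] [NormedSpace ℝ A] (φ : A → ENNReal)
    (a : A) (r : ℝ) : ENNReal :=
  belowOne √(‖a‖ ^ 2 + r ^ 2) * φ ((√(‖a‖ ^ 2 + r ^ 2))⁻¹ • a)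

section Conical

variable {n : ℕ} {φ : EuclideanSpace ℝ (Fin n) → ENNReal}

theorem conical_smul {r : ℝ} (hr : 0 < r) (a : EuclideanSpace ℝ (Fin n)) :
    conical φ (r • a) r = belowOne (r * √(1 + ‖a‖ ^ 2)) * φ ((√(1 + ‖a‖ ^ 2))⁻¹ • a) := by
  have hq : √(‖r • a‖ ^ 2 + r ^ 2) = r * √(1 + ‖a‖ ^ 2) := by
    rw [norm_smul, Real.norm_eq_abs, mul_pow, sq_abs,
      show r ^ 2 * ‖a‖ ^ 2 + r ^ 2 = r ^ 2 * (1 + ‖a‖ ^ 2) by ring,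
      Real.sqrt_mul (by positivity), Real.sqrt_sq hr.le]
  rw [conical, hq, smul_smul, _root_.mul_inv_rev, inv_mul_cancel_right₀ hr.ne']

theorem measurable_conical (hφ : Measurable φ) :
    Measurable fun p : EuclideanSpace ℝ (Fin n) × ℝ => conical φ p.1 p.2 := by
  unfold conical
  exact Measurable.mul (by fun_prop) (hφ.comp (by fun_prop))

/-- The substitution `a ↦ r a` makes the argument of `φ` independent of `r`, at the price of a
factor `r ^ n`; only the cutoff still couples `a` and `r`. -/
theorem lintegral_conical_of_pos (hφ : Measurable φ) (k : ℕ) {r : ℝ} (hr : 0 < r) :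
    ∫⁻ a, ENNReal.ofReal (r ^ k) * conical φ a r =
      ∫⁻ a, ENNReal.ofReal (r ^ (n + k)) * belowOne (r * √(1 + ‖a‖ ^ 2)) *
        φ ((√(1 + ‖a‖ ^ 2))⁻¹ • a) := by
  have hm : Measurable fun a => conical φ a r := by
    unfold conical
    exact Measurable.mul (by fun_prop) (hφ.comp (by fun_prop))
  have h := lintegral_comp_smul volume hm hr.ne'
  simp only [conical_smul hr, finrank_euclideanSpace_fin] at h
  simp only [mul_assoc]
  rw [lintegral_const_mul' (ENNReal.ofReal (r ^ k)) _ ENNReal.ofReal_ne_top,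
    lintegral_const_mul' (ENNReal.ofReal (r ^ (n + k))) _ ENNReal.ofReal_ne_top, h, ← mul_assoc,
    ← ENNReal.ofReal_mul (pow_nonneg hr.le _), abs_of_pos (inv_pos.2 (pow_pos hr n)), pow_add,
    mul_comm (r ^ n), mul_inv_cancel_right₀ (pow_ne_zero n hr.ne')]

/-- After the scaling of `a`, the radius can be integrated first: the cutoff `r < (1 + ‖a‖²)^(-1/2)`
contributes that bound to the power `n + k + 1`. -/
theorem lintegral_lintegral_conical (hφ : Measurable φ) (k : ℕ) :
    ∫⁻ a, (∫⁻ r in Set.Ioi (0 : ℝ), ENNReal.ofReal (r ^ k) * conical φ a r) =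
      radialMass (n + k) * ∫⁻ a, φ ((√(1 + ‖a‖ ^ 2))⁻¹ • a) *
        ENNReal.ofReal ((√(1 + ‖a‖ ^ 2))⁻¹ ^ (n + k + 1)) := by
  have hg : Measurable fun p : EuclideanSpace ℝ (Fin n) × ℝ =>
      ENNReal.ofReal (p.2 ^ k) * conical φ p.1 p.2 :=
    Measurable.mul (by fun_prop) (measurable_conical hφ)
  have hh : Measurable fun p : ℝ × EuclideanSpace ℝ (Fin n) =>
      ENNReal.ofReal (p.1 ^ (n + k)) * belowOne (p.1 * √(1 + ‖p.2‖ ^ 2)) *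
        φ ((√(1 + ‖p.2‖ ^ 2))⁻¹ • p.2) :=
    Measurable.mul (by fun_prop) (hφ.comp (by fun_prop))
  rw [lintegral_lintegral_swap (f := fun a r => ENNReal.ofReal (r ^ k) * conical φ a r)
    hg.aemeasurable, setLIntegral_congr_fun measurableSet_Ioi
      fun r hr => lintegral_conical_of_pos hφ k hr,
    lintegral_lintegral_swap (f := fun r a => ENNReal.ofReal (r ^ (n + k)) *
      belowOne (r * √(1 + ‖a‖ ^ 2)) * φ ((√(1 + ‖a‖ ^ 2))⁻¹ • a)) hh.aemeasurable,
    ← lintegral_const_mul' _ _ (radialMass_ne_top _)]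
  refine lintegral_congr fun a => ?_
  rw [lintegral_mul_const _ (by fun_prop),
    lintegral_radial_scaled _ (Real.sqrt_pos.2 (by positivity))]
  ring

end Conical

/-- One integral over the unit ball of `E` is computed twice: in polar coordinates of `E`, and by
splitting `v = (a, c)` with polar coordinates in `c` only. The common factor `radialMass (n + k)`,
finite and nonzero, cancels. -/
theorem lintegral_inlCoord_toSphere {n k : ℕ} {E : Type*} [NormedAddCommGroup E]
    [InnerProductSpace ℝ E] [MeasurableSpace E] [BorelSpace E] [FiniteDimensional ℝ E]
    (b : OrthonormalBasis (Fin n ⊕ Fin (k + 1)) ℝ E) {φ : EuclideanSpace ℝ (Fin n) → ENNReal}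
    (hφ : Measurable φ) :
    ∫⁻ u : Metric.sphere (0 : E) 1, φ (inlCoord b u) ∂(volume : Measure E).toSphere =
      (volume : Measure (EuclideanSpace ℝ (Fin (k + 1)))).toSphere Set.univ *
        ∫⁻ y, φ y * ENNReal.ofReal (posPartPow (1 - ‖y‖ ^ 2) (((k : ℝ) - 1) / 2)) := by
  have hcard : Module.finrank ℝ E = n + k + 1 := by
    rw [Module.finrank_eq_card_basis b.toBasis]
    simp [add_assoc]
  have : Nontrivial E := Module.nontrivial_of_finrank_pos (R := ℝ) (by omega)
  have hb := measurable_inlCoord b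
  -- The extension of `φ ∘ inlCoord b` from the sphere to the unit ball that is constant along rays.
  let G : E → ENNReal := fun v => belowOne ‖v‖ * φ (‖v‖⁻¹ • inlCoord b v)
  have hG : Measurable G := Measurable.mul (by fun_prop) (hφ.comp (by fun_prop))
  have hGs := hG.comp (measurePreserving_sumCoord b).measurable
  have h1 : ∫⁻ v, G v = radialMass (n + k) *
      ∫⁻ u : Metric.sphere (0 : E) 1, φ (inlCoord b u) ∂(volume : Measure E).toSphere := by
    rw [lintegral_polar volume hG, ← lintegral_const_mul' _ _ (radialMass_ne_top _)]
    refine lintegral_congr fun u => ?_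
    have hu : ‖(u : E)‖ = 1 := norm_eq_of_mem_sphere u
    rw [radialMass, ← lintegral_mul_const _ (by fun_prop), hcard, Nat.add_sub_cancel]
    refine setLIntegral_congr_fun measurableSet_Ioi fun r hr => ?_
    have hr : 0 < r := hr
    simp only [G, norm_smul, hu, mul_one, Real.norm_eq_abs, abs_of_pos hr, inlCoord_smul,
      inv_smul_smul₀ hr.ne', mul_assoc]
  have h2 : ∫⁻ v, G v = (volume : Measure (EuclideanSpace ℝ (Fin (k + 1)))).toSphere Set.univ *
      ∫⁻ a, (∫⁻ r in Set.Ioi (0 : ℝ), ENNReal.ofReal (r ^ k) * conical φ a r) := by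
    rw [← (measurePreserving_sumCoord b).lintegral_comp hG, Measure.volume_eq_prod,
      lintegral_prod _ (by exact hGs.aemeasurable),
      ← lintegral_const_mul' _ _ (measure_ne_top _ _)]
    refine lintegral_congr fun a => ?_
    rw [lintegral_polar volume (by exact hGs.comp measurable_prodMk_left), mul_comm,
      ← lintegral_const]
    refine lintegral_congr fun u => ?_
    have hu : ‖(u : EuclideanSpace ℝ (Fin (k + 1)))‖ = 1 := norm_eq_of_mem_sphere u
    simp only [G, conical, norm_sumCoord, inlCoord_sumCoord, norm_smul, hu, mul_one,
      Real.norm_eq_abs, sq_abs, finrank_euclideanSpace_fin, Nat.add_sub_cancel]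
  rw [h2, lintegral_lintegral_conical hφ, lintegral_ball_substitution n k hφ, mul_left_comm] at h1
  exact ((ENNReal.mul_right_inj (radialMass_ne_zero _) (radialMass_ne_top _)).1 h1).symm

/-! ### Gram matrices and generic independence of the rows -/

section Gram

variable {n d : ℕ}

theorem gramMatrix_eq_gram (Z : Fin n → EuclideanSpace ℝ (Fin d)) : gramMatrix Z = gram ℝ Z := by
  ext i j
  simp [gramMatrix, gram_apply, mul_apply, PiLp.inner_apply, mul_comm]

theorem posDef_gramMatrix_iff_linearIndependent {Z : Fin n → EuclideanSpace ℝ (Fin d)} :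
    (gramMatrix Z).PosDef ↔ LinearIndependent ℝ Z := by
  rw [gramMatrix_eq_gram, posDef_gram_iff_linearIndependent]

theorem posDef_gramMatrix_iff_det_ne_zero {Z : Fin n → EuclideanSpace ℝ (Fin d)} :
    (gramMatrix Z).PosDef ↔ (gramMatrix Z).det ≠ 0 := by
  rw [gramMatrix_eq_gram, posDef_gram_iff_linearIndependent, det_gram_ne_zero_iff_linearIndependent]

theorem continuous_gramMatrix :
    Continuous fun Z : Fin n → EuclideanSpace ℝ (Fin d) => gramMatrix Z := by
  unfold gramMatrix
  refine Continuous.matrix_mul ?_ (Continuous.matrix_transpose ?_) <;>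
    exact continuous_matrix fun i j => by simp only [of_apply]; fun_prop

theorem measurableSet_posDef_gramMatrix :
    MeasurableSet {Z : Fin n → EuclideanSpace ℝ (Fin d) | (gramMatrix Z).PosDef} := by
  simp only [posDef_gramMatrix_iff_det_ne_zero]
  exact (isOpen_ne_fun continuous_gramMatrix.matrix_det continuous_const).measurableSet

theorem ae_linearIndependent (h : n ≤ d) :
    ∀ᵐ Z : Fin n → EuclideanSpace ℝ (Fin d), LinearIndependent ℝ Z := by
  induction n with
  | zero => exact Filter.Eventually.of_forall fun Z => linearIndependent_empty_type
  | succ n ih =>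
    let e := MeasurableEquiv.piFinSuccAbove (fun _ : Fin (n + 1) => EuclideanSpace ℝ (Fin d)) 0
    have he : MeasurePreserving e :=
      volume_preserving_piFinSuccAbove (fun _ : Fin (n + 1) => EuclideanSpace ℝ (Fin d)) 0
    have hm : MeasurableSet {p : EuclideanSpace ℝ (Fin d) × (Fin n → EuclideanSpace ℝ (Fin d)) |
        LinearIndependent ℝ (e.symm p)} := by
      simp only [← posDef_gramMatrix_iff_linearIndependent]
      exact e.symm.measurable measurableSet_posDef_gramMatrix
    have h1 : ∀ᵐ p, LinearIndependent ℝ (e.symm p) := by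
      -- Fix the last `n` rows first: their span is a proper subspace, hence null, and almost every
      -- new row avoids it.
      rw [Measure.volume_eq_prod, Measure.ae_prod_iff_ae_ae hm, Measure.ae_ae_comm hm]
      filter_upwards [ih (Nat.le_of_succ_le h)] with v hv
      have hne : Submodule.span ℝ (Set.range v) ≠ ⊤ := by
        intro htop
        have h2 := finrank_range_le_card (R := ℝ) v
        rw [Set.finrank, htop, finrank_top, finrank_euclideanSpace_fin, Fintype.card_fin] at h2
        omega
      have h3 := Measure.addHaar_submodule volume _ hne
      filter_upwards [measure_eq_zero_iff_ae_notMem.1 h3] with x hx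
      have hcons : e.symm (x, v) = Fin.cons x v := Fin.insertNth_zero' x v
      rw [hcons, linearIndependent_finCons]
      exact ⟨hv, hx⟩
    have h4 := he.quasiMeasurePreserving.ae h1
    simpa using h4

end Gram

/-! ### The density of the inner products with a uniform direction -/

/-- The density, up to a constant, of the vector of inner products of the rows of `Z` with a uniform
point of the sphere. -/
noncomputable def projDensity {n d : ℕ} (y : Fin n → ℝ) (Z : Fin n → EuclideanSpace ℝ (Fin d)) : ℝ :=
  open Classical in
  if (gramMatrix Z).PosDef then
    (gramMatrix Z).det ^ (-(1 / 2) : ℝ) *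
      posPartPow (1 - y ⬝ᵥ ((gramMatrix Z)⁻¹ *ᵥ y)) (((d : ℝ) - n - 2) / 2)
  else 0

section ProjDensity

variable {n d : ℕ}

theorem unnormalizedDensity_eq (x : Fin n → ℝ) (Z : Fin n → EuclideanSpace ℝ (Fin d)) :
    unnormalizedDensity x Z =
      Real.exp (-(1 / 2) * (gramMatrix Z).trace) * projDensity x Z := by
  unfold unnormalizedDensity projDensity
  split_ifs <;> simp [mul_assoc]

theorem projDensity_nonneg (y : Fin n → ℝ) (Z : Fin n → EuclideanSpace ℝ (Fin d)) :
    0 ≤ projDensity y Z := by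
  unfold projDensity
  split_ifs with h
  · exact mul_nonneg (Real.rpow_nonneg h.det_pos.le _) (posPartPow_nonneg _ _)
  · rfl

theorem measurable_projDensity :
    Measurable fun p : (Fin n → ℝ) × (Fin n → EuclideanSpace ℝ (Fin d)) => projDensity p.1 p.2 := by
  unfold projDensity
  have hdet : Measurable fun p : (Fin n → ℝ) × (Fin n → EuclideanSpace ℝ (Fin d)) =>
      (gramMatrix p.2).det := (continuous_gramMatrix.matrix_det.comp continuous_snd).measurable
  have hadj (i j : Fin n) : Measurable fun p : (Fin n → ℝ) × (Fin n → EuclideanSpace ℝ (Fin d)) =>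
      (gramMatrix p.2).adjugate i j :=
    (((continuous_gramMatrix.matrix_adjugate.comp continuous_snd).matrix_elem i j)).measurable
  have hs : MeasurableSet {p : (Fin n → ℝ) × (Fin n → EuclideanSpace ℝ (Fin d)) |
      (gramMatrix p.2).PosDef} := measurable_snd measurableSet_posDef_gramMatrix
  have hq : Measurable fun p : (Fin n → ℝ) × (Fin n → EuclideanSpace ℝ (Fin d)) =>
      1 - p.1 ⬝ᵥ ((gramMatrix p.2)⁻¹ *ᵥ p.1) := by
    -- The adjugate is continuous in `Z`, so this formula reduces measurability of the inverse to
    -- that of `det⁻¹`.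
    have he (p : (Fin n → ℝ) × (Fin n → EuclideanSpace ℝ (Fin d))) :
        1 - p.1 ⬝ᵥ ((gramMatrix p.2)⁻¹ *ᵥ p.1) =
          1 - ∑ i, p.1 i * ∑ j, (gramMatrix p.2).det⁻¹ * (gramMatrix p.2).adjugate i j * p.1 j := by
      simp [dotProduct, mulVec, inv_def, Ring.inverse_eq_inv']
    simp only [he]
    refine measurable_const.sub (Finset.measurable_sum _ fun i _ => Measurable.mul (by fun_prop)
      (Finset.measurable_sum _ fun j _ => (hdet.inv.mul (hadj i j)).mul (by fun_prop)))
  exact Measurable.ite hs ((hdet.pow_const _).mul ((measurable_posPartPow _).comp hq))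
    measurable_const

theorem gramMatrix_smul (c : Fin n → ℝ) (Z : Fin n → EuclideanSpace ℝ (Fin d)) :
    gramMatrix (fun i => c i • Z i) = diagonal c * gramMatrix Z * diagonal c := by
  have h : (of fun i j => (c i • Z i) j : Matrix (Fin n) (Fin d) ℝ) =
      diagonal c * of fun i j => Z i j := by
    ext i j
    simp [diagonal_mul]
  rw [gramMatrix, h, gramMatrix, transpose_mul, diagonal_transpose]
  simp only [Matrix.mul_assoc]

/-- With `D = diagonal c`, the Gram matrix becomes `D H D` and `y` becomes `D y`, so the quadratic
form is unchanged and only the determinant contributes. -/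
theorem projDensity_smul (c y : Fin n → ℝ) (hc : ∀ i, c i ≠ 0)
    (Z : Fin n → EuclideanSpace ℝ (Fin d)) :
    projDensity (fun i => c i * y i) (fun i => c i • Z i) =
      |∏ i, c i|⁻¹ * projDensity y Z := by
  have hp : ∏ i, c i ≠ 0 := Finset.prod_ne_zero_iff.2 fun i _ => hc i
  have hdet : (gramMatrix fun i => c i • Z i).det = (∏ i, c i) ^ 2 * (gramMatrix Z).det := by
    rw [gramMatrix_smul, det_mul, det_mul, det_diagonal]
    ring
  have hpd : (gramMatrix fun i => c i • Z i).PosDef ↔ (gramMatrix Z).PosDef := by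
    rw [posDef_gramMatrix_iff_det_ne_zero, posDef_gramMatrix_iff_det_ne_zero, hdet]
    simp [hp]
  unfold projDensity
  by_cases h : (gramMatrix Z).PosDef
  · rw [if_pos h, if_pos (hpd.2 h), hdet]
    have hd : (diagonal c)⁻¹ = diagonal fun i => (c i)⁻¹ := by
      refine inv_eq_left_inv ?_
      rw [diagonal_mul_diagonal, ← diagonal_one]
      congr 1
      ext i
      simp [hc i]
    have hv : (diagonal fun i => (c i)⁻¹) *ᵥ (fun i => c i * y i) = y := by
      ext i
      simp [mulVec_diagonal, hc i]
    have hv' : (fun i => c i * y i) ᵥ* (diagonal fun i => (c i)⁻¹) = y := by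
      ext i
      rw [vecMul_diagonal, mul_comm, inv_mul_cancel_left₀ (hc i)]
    have hq : (fun i => c i * y i) ⬝ᵥ ((gramMatrix fun i => c i • Z i)⁻¹ *ᵥ fun i => c i * y i) =
        y ⬝ᵥ ((gramMatrix Z)⁻¹ *ᵥ y) := by
      rw [gramMatrix_smul, Matrix.mul_inv_rev, Matrix.mul_inv_rev, hd, ← mulVec_mulVec,
        ← mulVec_mulVec, hv, dotProduct_mulVec, hv']
    rw [hq, Real.mul_rpow (sq_nonneg _) h.det_pos.le, ← sq_abs (∏ i, c i),
      ← Real.rpow_natCast, ← Real.rpow_mul (abs_nonneg _)]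
    norm_num [Real.rpow_neg_one, mul_assoc]
  · rw [if_neg h, if_neg (hpd.not.2 h), mul_zero]

/-- Factor `H = M Mᵀ`. The rows of `M⁻¹ Z` are orthonormal, so the inner products are `M` applied to
`n` orthonormal coordinates of `u`. The map `y ↦ M y` carries the marginal over, with `‖y‖² = wᵀ H⁻¹
w` for `w = M y` and Jacobian `|det M|⁻¹ = det(H)^(-1/2)`. -/
theorem lintegral_inner_toSphere (k : ℕ) {Z : Fin n → EuclideanSpace ℝ (Fin (n + k + 1))}
    (hZ : (gramMatrix Z).PosDef) {φ : (Fin n → ℝ) → ENNReal} (hφ : Measurable φ) :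
    ∫⁻ u : UnitSphere (n + k + 1),
        φ (fun i => inner ℝ (u : EuclideanSpace ℝ (Fin (n + k + 1))) (Z i))
        ∂(volume : Measure (EuclideanSpace ℝ (Fin (n + k + 1)))).toSphere =
      (volume : Measure (EuclideanSpace ℝ (Fin (k + 1)))).toSphere Set.univ *
        ∫⁻ y, φ y * ENNReal.ofReal (projDensity y Z) := by
  obtain ⟨M, hH⟩ : ∃ M : Matrix (Fin n) (Fin n) ℝ, gramMatrix Z = M * Mᵀ := by
    obtain ⟨B, hB⟩ := CStarAlgebra.nonneg_iff_eq_star_mul_self.1 hZ.posSemidef.nonneg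
    refine ⟨Bᵀ, ?_⟩
    rw [hB, transpose_transpose, star_eq_conjTranspose, conjTranspose_eq_transpose_of_trivial]
  have hdH : (gramMatrix Z).det = M.det ^ 2 := by rw [hH, det_mul, det_transpose, sq]
  have hdet : M.det ≠ 0 := fun h => hZ.det_pos.ne' (by rw [hdH, h]; simp)
  have hu : IsUnit M.det := isUnit_iff_ne_zero.2 hdet
  have hut : IsUnit Mᵀ.det := by rwa [det_transpose]
  set W : Matrix (Fin n) (Fin (n + k + 1)) ℝ := of fun i j => Z i j with hW
  have hWW : W * Wᵀ = M * Mᵀ := hH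
  set Q := M⁻¹ * W with hQ
  have hQQ : Q * Qᵀ = 1 := by
    rw [hQ, transpose_mul, Matrix.mul_assoc, ← Matrix.mul_assoc W, hWW, transpose_nonsing_inv,
      Matrix.mul_assoc M, mul_nonsing_inv _ hut, Matrix.mul_one, nonsing_inv_mul _ hu]
  have hMQ : W = M * Q := by rw [hQ, ← Matrix.mul_assoc, mul_nonsing_inv _ hu, Matrix.one_mul]
  -- The zeros are placeholders: only the first `n` vectors are prescribed when extending to a
  -- basis.
  let q : Fin n ⊕ Fin (k + 1) → EuclideanSpace ℝ (Fin (n + k + 1)) :=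
    Sum.elim (fun i => WithLp.toLp 2 (Q i)) fun _ => 0
  have hort : Orthonormal ℝ ((Set.range (Sum.inl : Fin n → Fin n ⊕ Fin (k + 1))).domRestrict q) := by
    rw [orthonormal_iff_ite]
    rintro ⟨_, i, rfl⟩ ⟨_, j, rfl⟩
    have h := congrFun (congrFun hQQ i) j
    rw [one_apply, mul_apply] at h
    split_ifs with hs
    · rw [if_pos (Sum.inl.inj (congrArg Subtype.val hs))] at h
      simpa [q, PiLp.inner_apply, mul_comm] using h
    · rw [if_neg fun hij => hs (Subtype.ext (congrArg Sum.inl hij))] at h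
      simpa [q, PiLp.inner_apply, mul_comm] using h
  obtain ⟨b, hb⟩ := hort.exists_orthonormalBasis_extension_of_card_eq (by simp [add_assoc])
  have hinner (v : EuclideanSpace ℝ (Fin (n + k + 1))) :
      (fun i => inner ℝ v (Z i)) = M *ᵥ (inlCoord b v).ofLp := by
    ext i
    have hZi : Z i = ∑ j, M i j • b (Sum.inl j) := by
      ext l
      have h := congrFun (congrFun hMQ i) l
      rw [mul_apply] at h
      simpa [hb _ (Set.mem_range_self _), q, hW] using h
    simp [hZi, inner_sum, inner_smul_right, mulVec, dotProduct, inlCoord, real_inner_comm]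
  have hmul : Measurable fun y : Fin n → ℝ => M *ᵥ y := by
    have : Continuous fun y : Fin n → ℝ => M *ᵥ y := by fun_prop
    exact this.measurable
  let ψ : (Fin n → ℝ) → ENNReal := fun w => φ w *
    ENNReal.ofReal (posPartPow (1 - w ⬝ᵥ ((gramMatrix Z)⁻¹ *ᵥ w)) (((k : ℝ) - 1) / 2))
  have hψ : Measurable ψ := by
    refine hφ.mul ((measurable_posPartPow _).comp ?_).ennreal_ofReal
    have : Continuous fun w : Fin n → ℝ => 1 - w ⬝ᵥ ((gramMatrix Z)⁻¹ *ᵥ w) := by fun_prop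
    exact this.measurable
  have hnorm (y : EuclideanSpace ℝ (Fin n)) :
      ‖y‖ ^ 2 = (M *ᵥ y.ofLp) ⬝ᵥ ((gramMatrix Z)⁻¹ *ᵥ (M *ᵥ y.ofLp)) := by
    have h1 : Mᵀ * (gramMatrix Z)⁻¹ * M = 1 := by
      rw [hH, Matrix.mul_inv_rev, ← Matrix.mul_assoc, mul_nonsing_inv _ hut, Matrix.one_mul,
        nonsing_inv_mul _ hu]
    rw [← vecMul_transpose M, ← dotProduct_mulVec, vecMul_transpose, mulVec_mulVec, mulVec_mulVec, h1,
      one_mulVec, EuclideanSpace.real_norm_sq_eq]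
    simp [dotProduct, sq]
  calc _ = (volume : Measure (EuclideanSpace ℝ (Fin (k + 1)))).toSphere Set.univ *
        ∫⁻ y : EuclideanSpace ℝ (Fin n), ψ (M *ᵥ y.ofLp) := by
        simp_rw [hinner, ψ, ← hnorm]
        exact lintegral_inlCoord_toSphere b
          (φ := fun y => φ (M *ᵥ y.ofLp)) (hφ.comp (hmul.comp (by fun_prop)))
    _ = (volume : Measure (EuclideanSpace ℝ (Fin (k + 1)))).toSphere Set.univ *
        ∫⁻ y, ψ (M *ᵥ y) := by
        exact congrArg _ ((PiLp.volume_preserving_ofLp (Fin n)).lintegral_comp (hψ.comp hmul))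
    _ = (volume : Measure (EuclideanSpace ℝ (Fin (k + 1)))).toSphere Set.univ *
        (ENNReal.ofReal |M.det⁻¹| * ∫⁻ y, ψ y) := by
        rw [← smul_eq_mul (ENNReal.ofReal _), ← lintegral_smul_measure,
          ← Real.map_matrix_volume_pi_eq_smul_volume_pi hdet, lintegral_map hψ (by fun_prop)]
        rfl
    _ = _ := by
        rw [← lintegral_const_mul' _ _ ENNReal.ofReal_ne_top]
        congr 1
        refine lintegral_congr fun y => ?_
        have he : (((n + k + 1 : ℕ) : ℝ) - n - 2) / 2 = ((k : ℝ) - 1) / 2 := by push_cast; ring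
        have hr : (M.det ^ 2) ^ (-(1 / 2) : ℝ) = |M.det⁻¹| := by
          rw [← sq_abs, ← Real.rpow_natCast, ← Real.rpow_mul (abs_nonneg _), abs_inv,
            ← Real.rpow_neg_one]
          norm_num
        rw [projDensity, if_pos hZ, he, hdH, hr, ENNReal.ofReal_mul (abs_nonneg _)]
        ring

end ProjDensity

/-! ### Conditioning on the labels -/

section Conditioning

variable {n : ℕ} (d : ℕ)

theorem isProbabilityMeasure_uniformSphere (hd : 0 < d) : IsProbabilityMeasure (uniformSphere d) := by
  have : Nonempty (Fin d) := ⟨⟨0, hd⟩⟩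
  refine ⟨?_⟩
  rw [uniformSphere, Measure.smul_apply, smul_eq_mul]
  exact ENNReal.inv_mul_cancel (Measure.measure_univ_ne_zero.2 (Measure.toSphere_ne_zero _))
    (measure_ne_top _ _)

theorem isProbabilityMeasure_uniformOn_sign :
    IsProbabilityMeasure (uniformOn ({-1, 1} : Set ℝ)) :=
  isProbabilityMeasure_uniformOn (Set.toFinite _) (Set.insert_nonempty _ _)

instance isProbabilityMeasure_labelLaw : IsProbabilityMeasure (labelLaw n) := by
  have := isProbabilityMeasure_uniformOn_sign
  unfold labelLaw
  infer_instance

theorem labelLaw_singleton_ne_zero {x : Fin n → ℝ} (hx : ∀ i, x i = -1 ∨ x i = 1) :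
    labelLaw n {x} ≠ 0 := by
  have := isProbabilityMeasure_uniformOn_sign
  rw [labelLaw, Measure.pi_singleton, Finset.prod_ne_zero_iff]
  intro i _
  rw [Ne, uniformOn_eq_zero_iff (Set.toFinite _)]
  exact Set.Nonempty.ne_empty ⟨x i, hx i, rfl⟩

theorem clusteringLaw_label_inter (hd : 0 < d) (x : Fin n → ℝ)
    {s : Set (Fin n → EuclideanSpace ℝ (Fin d))} (hs : MeasurableSet s) :
    clusteringLaw n d ({ω | ω.1.2 = x} ∩ Prod.snd ⁻¹' s) =
      labelLaw n {x} * ∫⁻ u, sampleLaw u x s ∂uniformSphere d := by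
  have := isProbabilityMeasure_uniformSphere d hd
  have hA : MeasurableSet {ω : (UnitSphere d × (Fin n → ℝ)) ×
      (Fin n → EuclideanSpace ℝ (Fin d)) | ω.1.2 = x} :=
    (measurable_snd.comp measurable_fst) (measurableSet_singleton x)
  have hk (p : UnitSphere d × (Fin n → ℝ)) : sampleKernel n d p
      (Prod.mk p ⁻¹' ({ω | ω.1.2 = x} ∩ Prod.snd ⁻¹' s)) =
      ({x} : Set (Fin n → ℝ)).indicator (fun y => sampleLaw p.1 y s) p.2 := by
    by_cases hp : p.2 = x
    · rw [Set.indicator_of_mem (by exact hp)]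
      congr 1
      ext Z
      simp [hp]
    · rw [Set.indicator_of_notMem (by exact hp)]
      convert measure_empty (μ := sampleKernel n d p)
      ext Z
      simp [hp]
  have hm : Measurable fun p : UnitSphere d × (Fin n → ℝ) =>
      ({x} : Set (Fin n → ℝ)).indicator (fun y => sampleLaw p.1 y s) p.2 := by
    simp only [← hk]
    exact Kernel.measurable_kernel_prodMk_left (hA.inter (measurable_snd hs))
  rw [clusteringLaw, Measure.compProd_apply (hA.inter (measurable_snd hs))]
  simp only [hk]
  rw [lintegral_prod _ hm.aemeasurable, ← lintegral_const_mul' _ _ (measure_ne_top _ _)]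
  refine lintegral_congr fun u => ?_
  simp only
  rw [lintegral_indicator (measurableSet_singleton x), Measure.restrict_singleton,
    lintegral_smul_measure, lintegral_dirac, smul_eq_mul]

/-- The labels are independent of `u`, so conditioning on the event `x`, which has positive
probability, leaves `u` uniform. -/
theorem lawGivenLabels_apply (hd : 0 < d) {x : Fin n → ℝ} (hx : ∀ i, x i = -1 ∨ x i = 1)
    {s : Set (Fin n → EuclideanSpace ℝ (Fin d))} (hs : MeasurableSet s) :
    lawGivenLabels d x s = ∫⁻ u, sampleLaw u x s ∂uniformSphere d := by
  have := isProbabilityMeasure_uniformSphere d hd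
  have hA : MeasurableSet {ω : (UnitSphere d × (Fin n → ℝ)) ×
      (Fin n → EuclideanSpace ℝ (Fin d)) | ω.1.2 = x} :=
    (measurable_snd.comp measurable_fst) (measurableSet_singleton x)
  have hprob (u : UnitSphere d) : IsProbabilityMeasure (sampleLaw u x) :=
    IsMarkovKernel.isProbabilityMeasure (κ := sampleKernel n d) (u, x)
  have huniv : clusteringLaw n d {ω | ω.1.2 = x} = labelLaw n {x} := by
    have h := clusteringLaw_label_inter d hd x MeasurableSet.univ
    simpa using h
  rw [lawGivenLabels, Measure.map_apply measurable_snd hs, cond_apply hA,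
    clusteringLaw_label_inter d hd x hs, huniv, ← mul_assoc,
    ENNReal.inv_mul_cancel (labelLaw_singleton_ne_zero hx) (measure_ne_top _ _), one_mul]

end Conditioning

/-! ### Exchanging the integrals over `u`, `Z` and `y` -/

theorem trace_gramMatrix {n d : ℕ} (Z : Fin n → EuclideanSpace ℝ (Fin d)) :
    (gramMatrix Z).trace = ∑ i, ‖Z i‖ ^ 2 := by
  simp [gramMatrix_eq_gram, trace, gram_apply]

/-- The weight `∏ slabWeight` against a test function evaluated at the rescaled rows. -/
noncomputable def rescaled {n d : ℕ} (x : Fin n → ℝ)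
    (F : (Fin n → EuclideanSpace ℝ (Fin d)) → ENNReal) (y : Fin n → ℝ)
    (Z : Fin n → EuclideanSpace ℝ (Fin d)) : ENNReal :=
  (∏ i, slabWeight (x i) (y i) (Z i)) * F fun i => (x i / y i) • Z i

theorem measurable_slabWeight {d : ℕ} (ε : ℝ) :
    Measurable fun p : ℝ × EuclideanSpace ℝ (Fin d) => slabWeight ε p.1 p.2 := by
  unfold slabWeight
  exact Measurable.mul ((measurable_one.indicator measurableSet_Icc).comp (by fun_prop))
    (by fun_prop)

theorem slabWeight_ne_top {d : ℕ} (ε t : ℝ) (z : EuclideanSpace ℝ (Fin d)) :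
    slabWeight ε t z ≠ ⊤ := by
  refine ENNReal.mul_ne_top ?_ ENNReal.ofReal_ne_top
  by_cases h : t ∈ Set.Icc (1 : ℝ) 2 <;> simp [h]

theorem measurable_rescaled {n d : ℕ} (x : Fin n → ℝ)
    {F : (Fin n → EuclideanSpace ℝ (Fin d)) → ENNReal} (hF : Measurable F) :
    Measurable fun p : (Fin n → ℝ) × (Fin n → EuclideanSpace ℝ (Fin d)) =>
      rescaled x F p.1 p.2 := by
  unfold rescaled
  refine Measurable.mul (Finset.measurable_prod _ fun i _ => ?_) (hF.comp (by fun_prop))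
  exact (measurable_slabWeight (x i)).comp
    (f := fun p : (Fin n → ℝ) × (Fin n → EuclideanSpace ℝ (Fin d)) => (p.1 i, p.2 i)) (by fun_prop)

theorem exists_lintegral_sampleLaw_eq (n m : ℕ) :
    ∃ K : ENNReal, K ≠ 0 ∧ K ≠ ⊤ ∧ ∀ (u : UnitSphere (m + 1)) (x : Fin n → ℝ),
      (∀ i, x i = -1 ∨ x i = 1) →
      ∀ F : (Fin n → EuclideanSpace ℝ (Fin (m + 1))) → ENNReal, Measurable F →
        K * ∫⁻ Z, F Z ∂sampleLaw u x =
          ∫⁻ Z, rescaled x F (fun i => inner ℝ (u : EuclideanSpace ℝ (Fin (m + 1))) (Z i)) Z := by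
  obtain ⟨K, hK0, hKt, hK⟩ := exists_map_slabWeight_eq m
  refine ⟨K ^ n, pow_ne_zero _ hK0, ENNReal.pow_ne_top hKt, fun u x hx F hF => ?_⟩
  let w : Fin n → EuclideanSpace ℝ (Fin (m + 1)) → ENNReal := fun i z =>
    slabWeight (x i) (inner ℝ (u : EuclideanSpace ℝ (Fin (m + 1))) z) z
  let T : Fin n → EuclideanSpace ℝ (Fin (m + 1)) → EuclideanSpace ℝ (Fin (m + 1)) := fun i z =>
    (x i / inner ℝ (u : EuclideanSpace ℝ (Fin (m + 1))) z) • z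
  let N : Fin n → Measure (EuclideanSpace ℝ (Fin (m + 1))) := fun i =>
    multivariateGaussian (x i • (u : EuclideanSpace ℝ (Fin (m + 1)))) (clusterCov u)
  have hw (i : Fin n) : Measurable (w i) :=
    (measurable_slabWeight (x i)).comp
      (f := fun z => (inner ℝ (u : EuclideanSpace ℝ (Fin (m + 1))) z, z)) (by fun_prop)
  have hT (i : Fin n) : Measurable (T i) := by fun_prop
  have hrow (i : Fin n) : (volume.withDensity (w i)).map (T i) = K • N i := hK u (x i) (hx i)
  have hs1 (i : Fin n) : SigmaFinite (volume.withDensity (w i)) :=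
    SigmaFinite.withDensity_of_ne_top
      (Filter.Eventually.of_forall fun z => slabWeight_ne_top _ _ _)
  have hs2 (i : Fin n) : SigmaFinite ((volume.withDensity (w i)).map (T i)) := by
    rw [hrow i, ← withDensity_const]
    exact SigmaFinite.withDensity_of_ne_top (by simp [hKt])
  have hpi : (volume.withDensity fun Z : Fin n → EuclideanSpace ℝ (Fin (m + 1)) =>
      ∏ i, w i (Z i)).map (fun Z i => T i (Z i)) = K ^ n • sampleLaw u x := by
    have h := Measure.pi_map_pi (μ := fun i => volume.withDensity (w i)) (f := T)
      fun i => (hT i).aemeasurable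
    rw [pi_withDensity (fun _ => volume) w hw] at h
    refine h.trans ?_
    simp only [hrow]
    rw [pi_smul_measure N (fun _ => K) fun _ => hKt]
    simp [N, sampleLaw]
  have hW : Measurable fun Z : Fin n → EuclideanSpace ℝ (Fin (m + 1)) => ∏ i, w i (Z i) :=
    Finset.measurable_prod _ fun i _ => (hw i).comp (measurable_pi_apply i)
  have hTT : Measurable fun (Z : Fin n → EuclideanSpace ℝ (Fin (m + 1))) i => T i (Z i) :=
    measurable_pi_lambda _ fun i => (hT i).comp (measurable_pi_apply i)
  rw [← smul_eq_mul, ← lintegral_smul_measure, ← hpi, lintegral_map hF hTT,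
    lintegral_withDensity_eq_lintegral_mul _ hW (by exact hF.comp hTT)]
  rfl

/-- The Jacobian factor of the row scaling by `x i / y i`, on the slab `1 ≤ y i ≤ 2`. -/
noncomputable def slabJacobian (n d : ℕ) (y : Fin n → ℝ) : ENNReal :=
  (∏ i, (Set.Icc (1 : ℝ) 2).indicator 1 (y i)) *
    (ENNReal.ofReal |∏ i, (y i)⁻¹| * ENNReal.ofReal (∏ i, |y i ^ d|))

theorem measurable_slabJacobian (n d : ℕ) : Measurable (slabJacobian n d) := by
  unfold slabJacobian
  refine Measurable.mul (Finset.measurable_prod _ fun i _ => ?_) (by fun_prop)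
  exact (measurable_one.indicator measurableSet_Icc).comp (measurable_pi_apply i)

/-- The slab weights were chosen so that their product is `exp (-Tr H' / 2)` for the Gram matrix
`H'` of the rescaled rows. Scaling by `xᵢ / yᵢ` also moves `y` to `x`, so both factors of the target
density appear at the rescaled matrix. -/
theorem rescaled_mul_projDensity {n d : ℕ} {x : Fin n → ℝ} (hx : ∀ i, x i = -1 ∨ x i = 1)
    (F : (Fin n → EuclideanSpace ℝ (Fin d)) → ENNReal) {y : Fin n → ℝ}
    (hy : ∀ i, y i ∈ Set.Icc (1 : ℝ) 2) (Z : Fin n → EuclideanSpace ℝ (Fin d)) :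
    rescaled x F y Z * ENNReal.ofReal (projDensity y Z) =
      ENNReal.ofReal |∏ i, (y i)⁻¹| *
        (F (fun i => (x i / y i) • Z i) *
          ENNReal.ofReal (unnormalizedDensity x fun i => (x i / y i) • Z i)) := by
  have hy0 (i : Fin n) : y i ≠ 0 := by have := (hy i).1; positivity
  have hx0 (i : Fin n) : x i ≠ 0 := by rcases hx i with h | h <;> simp [h]
  have hxa (i : Fin n) : |x i| = 1 := by rcases hx i with h | h <;> simp [h]
  have h1 : ∏ i, slabWeight (x i) (y i) (Z i) = ENNReal.ofReal
      (Real.exp (-(1 / 2) * (gramMatrix fun i => (x i / y i) • Z i).trace)) := by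
    rw [trace_gramMatrix, Finset.mul_sum, Real.exp_sum,
      ENNReal.ofReal_prod_of_nonneg fun i _ => (Real.exp_pos _).le]
    exact Finset.prod_congr rfl fun i _ => by simp [slabWeight, hy i]
  have h2 := projDensity_smul (fun i => x i / y i) y (fun i => div_ne_zero (hx0 i) (hy0 i)) Z
  have h3 : (fun i => x i / y i * y i) = x := by
    ext i
    exact div_mul_cancel₀ _ (hy0 i)
  have h4 : |∏ i, x i / y i| = |∏ i, (y i)⁻¹| := by
    simp [Finset.abs_prod, abs_div, hxa]
  have h5 : projDensity y Z = |∏ i, (y i)⁻¹| * projDensity x fun i => (x i / y i) • Z i := by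
    rw [h3, h4] at h2
    rw [h2, mul_inv_cancel_left₀]
    exact abs_ne_zero.2 (Finset.prod_ne_zero_iff.2 fun i _ => inv_ne_zero (hy0 i))
  rw [rescaled, h1, h5, unnormalizedDensity_eq, ENNReal.ofReal_mul (abs_nonneg _),
    ENNReal.ofReal_mul (Real.exp_pos _).le]
  ring

theorem measurable_unnormalizedDensity {n d : ℕ} (x : Fin n → ℝ) :
    Measurable fun Z : Fin n → EuclideanSpace ℝ (Fin d) => unnormalizedDensity x Z := by
  simp only [unnormalizedDensity_eq]
  have h : Continuous fun Z : Fin n → EuclideanSpace ℝ (Fin d) =>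
      Real.exp (-(1 / 2) * (gramMatrix Z).trace) :=
    Real.continuous_exp.comp (continuous_const.mul continuous_gramMatrix.matrix_trace)
  refine h.measurable.mul ?_
  exact measurable_projDensity.comp (f := fun Z => (x, Z)) measurable_prodMk_left

theorem unnormalizedDensity_nonneg {n d : ℕ} (x : Fin n → ℝ)
    (Z : Fin n → EuclideanSpace ℝ (Fin d)) : 0 ≤ unnormalizedDensity x Z := by
  rw [unnormalizedDensity_eq]
  exact mul_nonneg (Real.exp_pos _).le (projDensity_nonneg x Z)

theorem lintegral_rescaled_mul_projDensity {n d : ℕ} {x : Fin n → ℝ}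
    (hx : ∀ i, x i = -1 ∨ x i = 1) {F : (Fin n → EuclideanSpace ℝ (Fin d)) → ENNReal}
    (hF : Measurable F) (y : Fin n → ℝ) :
    ∫⁻ Z, rescaled x F y Z * ENNReal.ofReal (projDensity y Z) =
      slabJacobian n d y * ∫⁻ Z, F Z * ENNReal.ofReal (unnormalizedDensity x Z) := by
  by_cases hy : ∀ i, y i ∈ Set.Icc (1 : ℝ) 2
  · have hx0 (i : Fin n) : x i ≠ 0 := by rcases hx i with h | h <;> simp [h]
    have hxa (i : Fin n) : |x i| = 1 := by rcases hx i with h | h <;> simp [h]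
    have hy0 (i : Fin n) : y i ≠ 0 := by have := (hy i).1; positivity
    have hm : Measurable fun Z => F Z * ENNReal.ofReal (unnormalizedDensity x Z) :=
      hF.mul (measurable_unnormalizedDensity x).ennreal_ofReal
    have hmap := pi_map_smul (volume : Measure (EuclideanSpace ℝ (Fin d)))
      (fun i => x i / y i) fun i => div_ne_zero (hx0 i) (hy0 i)
    -- As `|xᵢ| = 1`, the Jacobian does not see the labels; this keeps the final constant
    -- independent of `x`.
    have hprod : ∏ i, |((x i / y i) ^ d)⁻¹| = ∏ i, |y i ^ d| :=
      Finset.prod_congr rfl fun i _ => by simp [abs_div, abs_inv, abs_pow, hxa]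
    rw [finrank_euclideanSpace_fin, hprod] at hmap
    simp only [rescaled_mul_projDensity hx F hy]
    rw [lintegral_const_mul' _ _ ENNReal.ofReal_ne_top,
      ← lintegral_map (μ := volume) (g := fun (Z : Fin n → EuclideanSpace ℝ (Fin d)) i =>
        (x i / y i) • Z i) hm (by fun_prop), volume_pi, hmap, lintegral_smul_measure,
      smul_eq_mul, slabJacobian]
    simp [hy, mul_assoc]
  · obtain ⟨i, hi⟩ := not_forall.1 hy
    have h1 : ∏ i, (Set.Icc (1 : ℝ) 2).indicator (1 : ℝ → ENNReal) (y i) = 0 :=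
      Finset.prod_eq_zero (Finset.mem_univ i) (Set.indicator_of_notMem hi _)
    have h2 (Z : Fin n → EuclideanSpace ℝ (Fin d)) : rescaled x F y Z = 0 := by
      rw [rescaled, Finset.prod_eq_zero (Finset.mem_univ i), zero_mul]
      simp [slabWeight, Set.indicator_of_notMem hi]
    simp [slabJacobian, h1, h2]

theorem exists_lintegral_sampleLaw_uniformSphere_eq (n k : ℕ) :
    ∃ K C : ENNReal, K ≠ 0 ∧ K ≠ ⊤ ∧ ∀ x : Fin n → ℝ, (∀ i, x i = -1 ∨ x i = 1) →
      ∀ F : (Fin n → EuclideanSpace ℝ (Fin (n + k + 1))) → ENNReal, Measurable F →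
        K * ∫⁻ u, (∫⁻ Z, F Z ∂sampleLaw u x) ∂uniformSphere (n + k + 1) =
          C * ∫⁻ Z, F Z * ENNReal.ofReal (unnormalizedDensity x Z) := by
  obtain ⟨K, hK0, hKt, hK⟩ := exists_lintegral_sampleLaw_eq n (n + k)
  set σ := (volume : Measure (EuclideanSpace ℝ (Fin (n + k + 1)))).toSphere
  set S := (volume : Measure (EuclideanSpace ℝ (Fin (k + 1)))).toSphere Set.univ
  refine ⟨K, (σ Set.univ)⁻¹ * (S * ∫⁻ y, slabJacobian n (n + k + 1) y), hK0, hKt,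
    fun x hx F hF => ?_⟩
  have hR := measurable_rescaled x hF
  have hRu : Measurable fun p : UnitSphere (n + k + 1) ×
      (Fin n → EuclideanSpace ℝ (Fin (n + k + 1))) =>
      rescaled x F (fun i => inner ℝ (p.1 : EuclideanSpace ℝ (Fin (n + k + 1))) (p.2 i)) p.2 :=
    hR.comp (f := fun p : UnitSphere (n + k + 1) ×
      (Fin n → EuclideanSpace ℝ (Fin (n + k + 1))) =>
      ((fun i => inner ℝ (p.1 : EuclideanSpace ℝ (Fin (n + k + 1))) (p.2 i)), p.2)) (by fun_prop)
  have hRq : Measurable fun p : (Fin n → EuclideanSpace ℝ (Fin (n + k + 1))) × (Fin n → ℝ) =>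
      rescaled x F p.2 p.1 * ENNReal.ofReal (projDensity p.2 p.1) :=
    (hR.comp measurable_swap).mul (measurable_projDensity.comp measurable_swap).ennreal_ofReal
  have hmain : ∫⁻ u, (∫⁻ Z, rescaled x F
        (fun i => inner ℝ (u : EuclideanSpace ℝ (Fin (n + k + 1))) (Z i)) Z) ∂σ =
      S * ((∫⁻ y, slabJacobian n (n + k + 1) y) *
        ∫⁻ Z, F Z * ENNReal.ofReal (unnormalizedDensity x Z)) := by
    calc _ = ∫⁻ Z, ∫⁻ u, rescaled x F
          (fun i => inner ℝ (u : EuclideanSpace ℝ (Fin (n + k + 1))) (Z i)) Z ∂σ :=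
          lintegral_lintegral_swap hRu.aemeasurable
      _ = ∫⁻ Z, S * ∫⁻ y, rescaled x F y Z * ENNReal.ofReal (projDensity y Z) := by
          -- The inner-product density needs `H` positive definite, which holds for almost every `Z`
          -- because `n < d`.
          refine lintegral_congr_ae ?_
          filter_upwards [ae_linearIndependent (n := n) (d := n + k + 1) (by omega)] with Z hZ
          exact lintegral_inner_toSphere k (posDef_gramMatrix_iff_linearIndependent.2 hZ)
            (φ := fun y => rescaled x F y Z) (hR.comp measurable_prodMk_right)
      _ = S * ∫⁻ Z, ∫⁻ y, rescaled x F y Z * ENNReal.ofReal (projDensity y Z) :=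
          lintegral_const_mul' _ _ (measure_ne_top _ _)
      _ = S * ∫⁻ y, ∫⁻ Z, rescaled x F y Z * ENNReal.ofReal (projDensity y Z) := by
          rw [lintegral_lintegral_swap hRq.aemeasurable]
      _ = _ := by
          simp only [lintegral_rescaled_mul_projDensity hx hF]
          rw [lintegral_mul_const _ (measurable_slabJacobian n _)]
  rw [uniformSphere, lintegral_smul_measure, smul_eq_mul, mul_left_comm,
    ← lintegral_const_mul' _ _ hKt]
  simp only [hK _ x hx F hF]
  rw [hmain]
  ring

/-! ### Normalization and identification of the density -/

theorem mainTheorem5 (n d : ℕ) (hnd : n < d) :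
    ∃ c : ℝ, 0 < c ∧
      ∀ x : Fin n → ℝ, (∀ i, x i = -1 ∨ x i = 1) →
        Integrable (fun Z : Fin n → EuclideanSpace ℝ (Fin d) => unnormalizedDensity x Z) volume ∧
        ∫ Z : Fin n → EuclideanSpace ℝ (Fin d), unnormalizedDensity x Z = c ∧
        (lawGivenLabels d x).AbsolutelyContinuous volume ∧
        (lawGivenLabels d x).rnDeriv volume =ᵐ[volume]
          fun Z => ENNReal.ofReal (c⁻¹ * unnormalizedDensity x Z) := by
  obtain ⟨k, rfl⟩ : ∃ k, d = n + k + 1 := ⟨d - n - 1, by omega⟩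
  have := isProbabilityMeasure_uniformSphere (n + k + 1) (Nat.succ_pos _)
  obtain ⟨K, C, hK0, hKt, hKC⟩ := exists_lintegral_sampleLaw_uniformSphere_eq n k
  have hprob (u : UnitSphere (n + k + 1)) (x : Fin n → ℝ) : IsProbabilityMeasure (sampleLaw u x) :=
    IsMarkovKernel.isProbabilityMeasure (κ := sampleKernel n (n + k + 1)) (u, x)
  -- Testing against `1` gives `K = C · ∫ density`. Since `K` is neither `0` nor `⊤`, the same
  -- follows for `C`, and the integral is `K / C` for every `x`; integrability needs no separate
  -- estimate.
  have hone {x : Fin n → ℝ} (hx : ∀ i, x i = -1 ∨ x i = 1) :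
      K = C * ∫⁻ Z : Fin n → EuclideanSpace ℝ (Fin (n + k + 1)),
        ENNReal.ofReal (unnormalizedDensity x Z) := by
    simpa using hKC x hx 1 measurable_one
  have hC0 : C ≠ 0 := by
    rintro rfl
    exact hK0 (by simpa using hone (x := fun _ => 1) fun _ => Or.inr rfl)
  have hCt : C ≠ ⊤ := by
    rintro rfl
    have h := hone (x := fun _ => 1) fun _ => Or.inr rfl
    rw [ENNReal.top_mul'] at h
    split_ifs at h
    exacts [hK0 h, hKt h]
  have hc0 : K / C ≠ 0 := ENNReal.div_ne_zero.2 ⟨hK0, hCt⟩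
  have hct : K / C ≠ ⊤ := ENNReal.div_ne_top hKt hC0
  refine ⟨(K / C).toReal, ENNReal.toReal_pos hc0 hct, fun x hx => ?_⟩
  have hm := measurable_unnormalizedDensity (d := n + k + 1) x
  have hI : ∫⁻ Z : Fin n → EuclideanSpace ℝ (Fin (n + k + 1)),
      ENNReal.ofReal (unnormalizedDensity x Z) = K / C := by
    rw [ENNReal.eq_div_iff hC0 hCt, ← hone hx]
  have hnn : 0 ≤ᵐ[volume] fun Z : Fin n → EuclideanSpace ℝ (Fin (n + k + 1)) =>
      unnormalizedDensity x Z := Filter.Eventually.of_forall (unnormalizedDensity_nonneg x)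
  have hdens : lawGivenLabels (n + k + 1) x = volume.withDensity
      fun Z => ENNReal.ofReal ((K / C).toReal⁻¹ * unnormalizedDensity x Z) := by
    refine Measure.ext fun s hs => ?_
    have h := hKC x hx (s.indicator 1) (measurable_one.indicator hs)
    simp only [lintegral_indicator_one hs] at h
    have hind (Z : Fin n → EuclideanSpace ℝ (Fin (n + k + 1))) :
        s.indicator 1 Z * ENNReal.ofReal (unnormalizedDensity x Z) =
          s.indicator (fun Z => ENNReal.ofReal (unnormalizedDensity x Z)) Z := by
      by_cases hZ : Z ∈ s <;> simp [hZ]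
    simp only [hind] at h
    rw [lintegral_indicator hs] at h
    simp only [ENNReal.ofReal_mul (inv_nonneg.2 ENNReal.toReal_nonneg)]
    rw [lawGivenLabels_apply _ (Nat.succ_pos _) hx hs, withDensity_apply _ hs,
      lintegral_const_mul' _ _ ENNReal.ofReal_ne_top, ← ENNReal.toReal_inv,
      ENNReal.ofReal_toReal (ENNReal.inv_ne_top.2 hc0), ENNReal.inv_div (Or.inl hCt) (Or.inl hC0),
      ENNReal.div_eq_inv_mul, mul_assoc, ← h, ← mul_assoc, ENNReal.inv_mul_cancel hK0 hKt, one_mul]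
  refine ⟨⟨hm.aestronglyMeasurable, ?_⟩, ?_, ?_, ?_⟩
  · rw [hasFiniteIntegral_iff_ofReal hnn, hI]
    exact hct.lt_top
  · rw [integral_eq_lintegral_of_nonneg_ae hnn hm.aestronglyMeasurable, hI]
  · rw [hdens]
    exact withDensity_absolutelyContinuous _ _
  · rw [hdens]
    exact Measure.rnDeriv_withDensity _ (hm.const_mul _).ennreal_ofReal
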